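/- Let $1\le n\le L$, $\gamma,\phi_1,\phi_2\in\mathbb C$ with $\phi_1\ne 0$, $\mu_1,\dots,\mu_L\in\mathbb C$, and put $a(x)=\sinh(x+\gamma)$, $b(x)=\sinh x$, $c=\sinh\gamma$. Let $\mathcal R(x)\in\mathrm{End}(\mathbb C^2\otimes\mathbb C^2)$ be the matrix with rows $(a,0,0,0),(0,b,c,0),(0,c,b,0),(0,0,0,a)$, let $$\mathcal T(\lambda)=\mathcal R_{a1}(\lambda-\mu_1)\cdots\mathcal R_{aL}(\lambda-\mu_L)=\begin{pmatrix}A(\lambda)&B(\lambda)\\ C(\lambda)&D(\lambda)\end{pmatrix},$$ with operator entries on $(\mathbb C^2)^{\otimes L}$, let $|0\rangle=\binom10^{\otimes L}$ and $$S_n(\lambda^C|\lambda^B)=\langle 0|\,C(\lambda_1^C)\cdots C(\lambda_n^C)\,B(\lambda_1^B)\cdots B(\lambda_n^B)\,|0\rangle .$$ Let $\lambda^C_1,\dots,\lambda^C_n\in\mathbb C$ be arbitrary, and let $\lambda^B_1,\dots,\lambda^B_n$ be pairwise distinct and satisfy, with non-vanishing denominators, the twisted Bethe ansatz equations $$\prod_{j=1}^{L}\frac{a(\lambda_i^B-\mu_j)}{b(\lambda_i^B-\mu_j)}=(-1)^{n-1}\frac{\phi_2}{\phi_1}\prod_{k\ne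 i}\frac{a(\lambda_i^B-\lambda_k^B)}{a(\lambda_k^B-\lambda_i^B)},\qquad 1\le i\le n .$$ For $w,\bar w\in\mathbb C^n$ put $$R_i=\prod_{k=i}^n\frac{a(w_k-\mu_i)}{b(w_k-\mu_i)}-\prod_{k=i}^n\frac{a(\bar w_k-\mu_i)}{b(\bar w_k-\mu_i)},$$ $$\Lambda_i^{\rm ON}=\frac{(-1)^n}{\prod_{k<i}b(\bar w_i-\mu_k)}\prod_{k=i}^{L}a(w_i-\mu_k)\prod_{k=i+1}^n a(w_k-w_i)+\frac{\phi_2\phi_1^{-1}}{\prod_{k<i}a(\bar w_i-\mu_k)}\prod_{k=i}^{L}b(w_i-\mu_k)\prod_{k=i+1}^n a(w_i-w_k)\prod_{k=1}^{i-1}\frac{a(\bar w_i-\bar w_k)}{a(\bar w_k-\bar w_i)},$$ $$H(w|\bar w)=(-1)^{\frac{n(n+1)}2}c^{2n}\,\frac{\prod_{i=1}^n\prod_{j=1}^L b(\bar w_i-\mu_j)\prod_{i<j}a(\bar w_i-\bar w_j)a(\bar w_j-\mu_i)b(\bar w_j-\bar w_i)}{\prod_{i=1}^n b(\bar w_i-\mu_i)}\;\frac{\prod_{i<j}a(w_j-\mu_i)b(w_j-w_i)}{\prod_{i=1}^n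 b(w_i-\mu_i)}\;\prod_{i=1}^n R_i^{-1}\Lambda_i^{\rm ON}.$$ (1) Let $\Gamma_C$ and $\Gamma_B$ each be the union of the positively oriented boundary circles of finitely many pairwise disjoint closed discs such that every $\lambda_j^C$ (resp. $\lambda_j^B$) lies in the interior of one of the discs, and the closed discs contain no zero of $\prod_j b(z-\lambda_j^C)$ (resp. $\prod_j b(z-\lambda_j^B)$) other than the points $\lambda_j^C$ (resp. $\lambda_j^B$) themselves. Suppose that, whenever all $w_k$ are on $\Gamma_C$ and all $\bar w_k$ on $\Gamma_B$, the numbers $b(w_k-\mu_i)$, $b(\bar w_k-\mu_i)$ $(i\le k)$, $a(\bar w_k-\mu_i)$, $a(\bar w_i-\bar w_k)$ $(i<k)$ are non-zero, and that the contours enclose no poles of $H$ coming from the zeros of the $R_i$: for each $i$, $\prod_{k=i}^n a(w_k-\mu_i)b(\bar w_k-\mu_i)\ne\prod_{k=i}^n a(\bar w_k-\mu_i)b(w_k-\mu_i)$ whenever all $w_k$ lie in the closed discs of $\Gamma_C$ and all $\bar w_k$ in those of $\Gamma_B$. Then $$S_n(\lambda^C|\lambda^B)=\oint_{\Gamma_C}\!\!\cdots\oint_{\Gamma_C}\oint_{\Gamma_B}\!\!\cdots\oint_{\Gamma_B}\prod_{i=1}^n\frac{dw_i}{2\pi\mathrm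 i}\frac{d\bar w_i}{2\pi\mathrm i}\;\frac{H(w_1,\dots,w_n|\bar w_1,\dots,\bar w_n)}{\prod_{i,j=1}^n b(w_i-\lambda_j^C)\,b(\bar w_i-\lambda_j^B)} .$$ (2) Suppose $a(\mu_s-\mu_k)\ne0\ne a(\mu_k-\mu_s)$ for $1\le s<n$, $s<k\le L$. Define $H^{(n)},\dots,H^{(1)}$ by $$H^{(n)}=(-1)^n c^2\,\frac{\prod_{k=1}^L b(\bar w_n-\mu_k)}{b(w_n-\mu_n)b(\bar w_n-\mu_n)}\,R_n^{-1}\Lambda_n^{\rm ON},$$ $$H^{(s)}=\frac{(-1)^L\prod_{k=1}^L b(\bar w_s-\mu_k)\prod_{k=s+1}^n a(w_k-\mu_s)b(w_k-w_s)}{b(w_s-\mu_s)b(\bar w_s-\mu_s)\prod_{k=s+1}^L a(\mu_s-\mu_k)a(\mu_k-\mu_s)}\prod_{k=s+1}^n a(\bar w_s-\bar w_k)a(\bar w_k-\mu_s)b(\bar w_k-\bar w_s)\;R_s^{-1}\Lambda_s^{\rm ON}\,H^{(s+1)}\quad(1\le s\le n-1).$$ Then the kernel is obtained, up to a normalisation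 depending only on $n$, $L$, $\gamma$ and the $\mu_j$, by iterating this recursion: $$H=(-1)^{(n-1)\left(L+\frac n2\right)}c^{2(n-1)}\prod_{s=1}^{n-1}\prod_{k=s+1}^L a(\mu_s-\mu_k)a(\mu_k-\mu_s)\;H^{(1)} .$$ -/

import Mathlib

open Complex

namespace SixVertex

/-! ## The six-vertex weights and the monodromy matrix -/

/-- The weight `a(x) = sinh (x + γ)`. -/
noncomputable def wa (γ x : ℂ) : ℂ := sinh (x + γ)

/-- The weight `b(x) = sinh x`. -/
noncomputable def wb (x : ℂ) : ℂ := sinh x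

/-- The weight `c = sinh γ`. -/
noncomputable def wc (γ : ℂ) : ℂ := sinh γ

/-- The matrix `R(x)` on `ℂ² ⊗ ℂ²`; the basis vector `e_p ⊗ e_q` has index `(p, q)`, so that in the
order `(0,0), (0,1), (1,0), (1,1)` its rows are `(a,0,0,0)`, `(0,b,c,0)`, `(0,c,b,0)`, `(0,0,0,a)`. -/
noncomputable def rMatrix (γ x : ℂ) : Matrix (Fin 2 × Fin 2) (Fin 2 × Fin 2) ℂ :=
  fun s t =>
    if s = t then (if s.1 = s.2 then wa γ x else wb x)
    else if s.1 = t.2 ∧ s.2 = t.1 then wc γ else 0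

/-- Operators on `V₁ ⊗ ⋯ ⊗ V_L` with `V_j = ℂ²`, as matrices in the product basis: the basis vector
`e_{s 1} ⊗ ⋯ ⊗ e_{s L}` has the index `s : Fin L → Fin 2`. -/
abbrev QuantumOp (L : ℕ) : Type := Matrix (Fin L → Fin 2) (Fin L → Fin 2) ℂ

/-- The operator `R_{aj}(x)` on `V_a ⊗ V₁ ⊗ ⋯ ⊗ V_L`, written as a `2 × 2` matrix in the auxiliary
space `V_a` whose entries are operators on `V₁ ⊗ ⋯ ⊗ V_L`; it acts as `R(x)` on `V_a ⊗ V_j` and as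
the identity on the other factors. -/
noncomputable def rLocal {L : ℕ} (γ x : ℂ) (j : Fin L) : Matrix (Fin 2) (Fin 2) (QuantumOp L) :=
  fun p q => fun s t =>
    if ∀ k, k ≠ j → s k = t k then rMatrix γ x (p, s j) (q, t j) else 0

/-- The monodromy matrix `R_{a1}(x - μ₁) R_{a2}(x - μ₂) ⋯ R_{aL}(x - μ_L)`. -/
noncomputable def monodromy {L : ℕ} (γ : ℂ) (μ : Fin L → ℂ) (x : ℂ) :
    Matrix (Fin 2) (Fin 2) (QuantumOp L) :=
  (List.ofFn fun j => rLocal γ (x - μ j) j).prod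

/-- The operator `B(x)`, the upper right entry of the monodromy matrix. -/
noncomputable def opB {L : ℕ} (γ : ℂ) (μ : Fin L → ℂ) (x : ℂ) : QuantumOp L :=
  monodromy γ μ x 0 1

/-- The operator `C(x)`, the lower left entry of the monodromy matrix. -/
noncomputable def opC {L : ℕ} (γ : ℂ) (μ : Fin L → ℂ) (x : ℂ) : QuantumOp L :=
  monodromy γ μ x 1 0

/-- The vector `|0⟩ = e₀ ⊗ ⋯ ⊗ e₀`. -/
def vacuum (L : ℕ) : (Fin L → Fin 2) → ℂ := Pi.single (fun _ => 0) 1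

/-- The scalar product
`S_n(x₁, …, x_n | y₁, …, y_n) = ⟨0| C(x₁) ⋯ C(x_n) B(y₁) ⋯ B(y_n) |0⟩`. -/
noncomputable def scalarProduct {L n : ℕ} (γ : ℂ) (μ : Fin L → ℂ) (x y : Fin n → ℂ) : ℂ :=
  vacuum L ⬝ᵥ
    (((List.ofFn fun i => opC γ μ (x i)).prod * (List.ofFn fun i => opB γ μ (y i)).prod).mulVec
      (vacuum L))

/-- The Bethe ansatz equations with twist `φ₂ / φ₁` for `y₁, …, y_n`, all of whose denominators are
required not to vanish. -/
structure BetheEquations {L n : ℕ} (γ φ₁ φ₂ : ℂ) (μ : Fin L → ℂ) (y : Fin n → ℂ) : Prop where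
  twist_ne_zero : φ₁ ≠ 0
  b_ne_zero : ∀ i j, wb (y i - μ j) ≠ 0
  a_ne_zero : ∀ i k, k ≠ i → wa γ (y k - y i) ≠ 0
  equation : ∀ i,
    ∏ j, wa γ (y i - μ j) / wb (y i - μ j) =
      (-1) ^ (n - 1) * (φ₂ / φ₁) *
        ∏ k ∈ Finset.univ.erase i, wa γ (y i - y k) / wa γ (y k - y i)

/-! ## The kernel of the integral formula

Throughout, `w = (w₁, …, w_n)`, `v = (w̄₁, …, w̄_n)`, and for `h : n ≤ L` the number `μ_i` with
`i ≤ n` is `μ (Fin.castLE h i)`. -/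

section Kernel

variable {L n : ℕ} (h : n ≤ L) (γ φ₁ φ₂ : ℂ) (μ : Fin L → ℂ)

/-- `R_i = ∏_{k=i}^n a(w_k - μ_i)/b(w_k - μ_i) - ∏_{k=i}^n a(w̄_k - μ_i)/b(w̄_k - μ_i)`. -/
noncomputable def factorR (w v : Fin n → ℂ) (i : Fin n) : ℂ :=
  ∏ k ∈ Finset.Ici i, wa γ (w k - μ (Fin.castLE h i)) / wb (w k - μ (Fin.castLE h i)) -
    ∏ k ∈ Finset.Ici i, wa γ (v k - μ (Fin.castLE h i)) / wb (v k - μ (Fin.castLE h i))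

/-- The numerator of `R_i`, that is `R_i` times `∏_{k=i}^n b(w_k - μ_i) b(w̄_k - μ_i)`. -/
noncomputable def numeratorR (w v : Fin n → ℂ) (i : Fin n) : ℂ :=
  ∏ k ∈ Finset.Ici i, wa γ (w k - μ (Fin.castLE h i)) * wb (v k - μ (Fin.castLE h i)) -
    ∏ k ∈ Finset.Ici i, wa γ (v k - μ (Fin.castLE h i)) * wb (w k - μ (Fin.castLE h i))

/-- The twist-dependent factor `Λ_i^{ON}`. -/
noncomputable def lambdaON (w v : Fin n → ℂ) (i : Fin n) : ℂ :=
  (-1) ^ n / (∏ k ∈ Finset.Iio (Fin.castLE h i), wb (v i - μ k)) *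
      (∏ k ∈ Finset.Ici (Fin.castLE h i), wa γ (w i - μ k)) *
      (∏ k ∈ Finset.Ioi i, wa γ (w k - w i)) +
    φ₂ * φ₁⁻¹ / (∏ k ∈ Finset.Iio (Fin.castLE h i), wa γ (v i - μ k)) *
      (∏ k ∈ Finset.Ici (Fin.castLE h i), wb (w i - μ k)) *
      (∏ k ∈ Finset.Ioi i, wa γ (w i - w k)) *
      (∏ k ∈ Finset.Iio i, wa γ (v i - v k) / wa γ (v k - v i))

/-- The on-shell kernel `H(w₁, …, w_n | w̄₁, …, w̄_n)`. -/
noncomputable def kernelON (w v : Fin n → ℂ) : ℂ :=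
  (-1) ^ (n * (n + 1) / 2) * wc γ ^ (2 * n) *
    (((∏ i, ∏ j, wb (v i - μ j)) *
        ∏ i, ∏ j ∈ Finset.Ioi i,
          wa γ (v i - v j) * wa γ (v j - μ (Fin.castLE h i)) * wb (v j - v i)) /
      ∏ i, wb (v i - μ (Fin.castLE h i))) *
    ((∏ i, ∏ j ∈ Finset.Ioi i, wa γ (w j - μ (Fin.castLE h i)) * wb (w j - w i)) /
      ∏ i, wb (w i - μ (Fin.castLE h i))) *
    ∏ i, (factorR h γ μ w v i)⁻¹ * lambdaON h γ φ₁ φ₂ μ w v i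

/-- The last term `H^{(n)}(w_n | w̄_n)` of the recursion; `s` is the last index. -/
noncomputable def recLast (w v : Fin n → ℂ) (s : Fin n) : ℂ :=
  (-1) ^ n * wc γ ^ 2 *
    ((∏ k, wb (v s - μ k)) / (wb (w s - μ (Fin.castLE h s)) * wb (v s - μ (Fin.castLE h s)))) *
    (factorR h γ μ w v s)⁻¹ * lambdaON h γ φ₁ φ₂ μ w v s

/-- The coefficient of `H^{(s+1)}` in the recursion for `H^{(s)}`. -/
noncomputable def recCoeff (w v : Fin n → ℂ) (s : Fin n) : ℂ :=
  ((-1) ^ L * (∏ k, wb (v s - μ k)) *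
      (∏ k ∈ Finset.Ioi s, wa γ (w k - μ (Fin.castLE h s)) * wb (w k - w s)) /
    (wb (w s - μ (Fin.castLE h s)) * wb (v s - μ (Fin.castLE h s)) *
      ∏ k ∈ Finset.Ioi (Fin.castLE h s),
        wa γ (μ (Fin.castLE h s) - μ k) * wa γ (μ k - μ (Fin.castLE h s)))) *
    (∏ k ∈ Finset.Ioi s,
      wa γ (v s - v k) * wa γ (v k - μ (Fin.castLE h s)) * wb (v k - v s)) *
    (factorR h γ μ w v s)⁻¹ * lambdaON h γ φ₁ φ₂ μ w v s

/-- The functions `H^{(s)}`, from `H^{(n)}` downwards. The index `s` counts from `0`, so `H^{(1)}` is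
`kernelRec 0`. -/
noncomputable def kernelRec (w v : Fin n → ℂ) (s : ℕ) (hs : s < n) : ℂ :=
  if hs' : s + 1 < n then
    recCoeff h γ φ₁ φ₂ μ w v ⟨s, hs⟩ * kernelRec w v (s + 1) hs'
  else recLast h γ φ₁ φ₂ μ w v ⟨s, hs⟩
termination_by n - s

/-- The normalisation
`(-1)^{(n-1)L + n(n-1)/2} c^{2(n-1)} ∏_{s=1}^{n-1} ∏_{k=s+1}^L a(μ_s - μ_k) a(μ_k - μ_s)`
relating the kernel to the recursion. -/
noncomputable def recNorm : ℂ :=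
  (-1) ^ ((n - 1) * L + n * (n - 1) / 2) * wc γ ^ (2 * (n - 1)) *
    ∏ s ∈ Finset.univ.filter (fun s : Fin n => (s : ℕ) + 1 < n),
      ∏ k ∈ Finset.Ioi (Fin.castLE h s),
        wa γ (μ (Fin.castLE h s) - μ k) * wa γ (μ k - μ (Fin.castLE h s))

/-- None of the denominators in the formula for `H` vanishes at `(w, v)`, except possibly `R_i`. -/
structure RegularAt (w v : Fin n → ℂ) : Prop where
  w_mu : ∀ i k, i ≤ k → wb (w k - μ (Fin.castLE h i)) ≠ 0
  v_mu : ∀ i k, i ≤ k → wb (v k - μ (Fin.castLE h i)) ≠ 0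
  v_mu' : ∀ i k, k < i → wa γ (v i - μ (Fin.castLE h k)) ≠ 0
  v_v : ∀ i k, k < i → wa γ (v k - v i) ≠ 0

end Kernel

/-! ## Contours -/

/-- A contour is a finite union of positively oriented circles, each given by its centre and its
radius. This is the set of its points. -/
def curve (Γ : Finset (ℂ × ℝ)) : Set ℂ := ⋃ d ∈ Γ, Metric.sphere d.1 d.2

/-- The closed region bounded by a contour. -/
def region (Γ : Finset (ℂ × ℝ)) : Set ℂ := ⋃ d ∈ Γ, Metric.closedBall d.1 d.2

/-- The contour `Γ` consists of boundaries of disjoint discs, encloses each of the points `p_j`, and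
neither meets nor encloses any zero of `∏_j b(z - p_j)` other than the points `p_j` themselves. -/
structure Encloses {n : ℕ} (Γ : Finset (ℂ × ℝ)) (p : Fin n → ℂ) : Prop where
  radius_pos : ∀ d ∈ Γ, 0 < d.2
  disjoint : (Γ : Set (ℂ × ℝ)).PairwiseDisjoint fun d => Metric.closedBall d.1 d.2
  mem : ∀ j, ∃ d ∈ Γ, p j ∈ Metric.ball d.1 d.2
  solely : ∀ z ∈ region Γ, ∀ j, wb (z - p j) = 0 → z = p j

/-- The `n`-fold contour integral `∮ ⋯ ∮ f(w₁, …, w_n) ∏ dw_i / (2πi)`, each `w_i` running over all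
circles of `Γ`. -/
noncomputable def contourIntegral {n : ℕ} (Γ : Finset (ℂ × ℝ)) (f : (Fin n → ℂ) → ℂ) : ℂ :=
  (∑ d : Fin n → Γ, ∯ w in T(fun i => (d i).1.1, fun i => (d i).1.2), f w) /
    (2 * (Real.pi : ℂ) * I) ^ n

end SixVertex

/-! The heart of the proof is a recursion that removes the first site together with one argument of
each kind. Attach to a chain with monodromy `T` one more site of inhomogeneity `ν`, either to the
left or to the right of the others. Reading the second auxiliary space of the RTT relation as this
site shows that `T ν` intertwines the two extensions (`left_mul_eq_mul_right`). Since the reference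
state is an eigenvector of the diagonal entries of `T ν` and is annihilated by the relevant
off-diagonal ones, the scalar products of both extensions agree (`HighestWeight.left_eq_right`). In
each extension `C` and `B` are triangular in the new site, so the algebraic Bethe ansatz expands the
scalar product into that of the original chain plus a double sum with one `x` and one `y` removed.
Equating the two expansions expresses `S_n` by the `S_{n-1}` of the same chain
(`HighestWeight.pairing_eq_sum`). Taking `ν` to be the inhomogeneity of the first site and
eliminating `S_n` of the shorter chain gives `numerator_mul_scalarProduct`, whose prefactor is the
numerator of `R_1`.

Iterating `n` times leaves a sum over pairs of permutations (`scalarProduct_eq_sum`). This is a sum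
of residues of `∏ 1 / b` against a kernel valid for arbitrary arguments, whose `i`-th factor
contains a difference of two products. The kernel vanishes on repeated arguments, so the sum may run
over all maps. The Bethe equations pull the dependence on `v` out of that difference and leave `Λ_i`
(`regKernel_eq_offKernel`); they are stable under permutation, hence available at every residue.

The kernel `H` has removable singularities inside the contours. Cleared of them it becomes
`regKernel`, whose only denominators are the numerators of the `R_i`, so the poles inside the
contours are those of the `b`-products and the integrals are sums of residues
(`Encloses.contourIntegral_div`). This requires distinct arguments; coinciding `λ^C` are reached by
continuity from enclosed distinct points (`Encloses.exists_deformation`). The second claim is the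
unrolling of the recursion, with bookkeeping of signs (`kernelON_eq_recNorm_mul`). -/

namespace SixVertex

open Matrix

/-! ### The RTT relation and the exchange relations it implies. -/

section RTT

variable {𝒜 ℬ : Type*} [Ring 𝒜] [Algebra ℂ 𝒜] [Ring ℬ] [Algebra ℂ ℬ]

/-- `U₁ V₂` on the product of two auxiliary spaces. -/
def tensorMul (U V : Matrix (Fin 2) (Fin 2) 𝒜) : Matrix (Fin 2 × Fin 2) (Fin 2 × Fin 2) 𝒜 :=
  fun s t => U s.1 t.1 * V s.2 t.2

/-- `V₂ U₁` on the product of two auxiliary spaces. -/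
def tensorMulOp (U V : Matrix (Fin 2) (Fin 2) 𝒜) : Matrix (Fin 2 × Fin 2) (Fin 2 × Fin 2) 𝒜 :=
  fun s t => V s.2 t.2 * U s.1 t.1

/-- The relation `R₁₂(x - y) T₁(x) T₂(y) = T₂(y) T₁(x) R₁₂(x - y)`. -/
def IsMonodromy (γ : ℂ) (T : ℂ → Matrix (Fin 2) (Fin 2) 𝒜) : Prop :=
  ∀ x y, (rMatrix γ (x - y)).map (algebraMap ℂ 𝒜) * tensorMul (T x) (T y) =
    tensorMulOp (T x) (T y) * (rMatrix γ (x - y)).map (algebraMap ℂ 𝒜)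

/-- Comultiplication: commuting entries let the products over the two auxiliary spaces factor, and
`R` is then carried through `U` and `V` in turn. -/
lemma IsMonodromy.mul {γ : ℂ} {U V : ℂ → Matrix (Fin 2) (Fin 2) 𝒜} (hU : IsMonodromy γ U)
    (hV : IsMonodromy γ V) (hUV : ∀ x y p q r s, Commute (U x p q) (V y r s)) :
    IsMonodromy γ fun x => U x * V x := by
  intro x y
  have h1 : tensorMul (U x * V x) (U y * V y) =
      tensorMul (U x) (U y) * tensorMul (V x) (V y) := by
    ext s t
    simp only [tensorMul, Matrix.mul_apply, Fintype.sum_prod_type, Finset.sum_mul_sum]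
    refine Finset.sum_congr rfl fun i _ => Finset.sum_congr rfl fun j _ => ?_
    rw [mul_assoc, ← mul_assoc (V x i t.1), ← (hUV y x s.2 j i t.1).eq]
    simp only [mul_assoc]
  have h2 : tensorMulOp (U x * V x) (U y * V y) =
      tensorMulOp (U x) (U y) * tensorMulOp (V x) (V y) := by
    ext s t
    simp only [tensorMulOp, Matrix.mul_apply, Fintype.sum_prod_type, Finset.sum_mul_sum]
    rw [Finset.sum_comm]
    refine Finset.sum_congr rfl fun i _ => Finset.sum_congr rfl fun j _ => ?_
    rw [mul_assoc, ← mul_assoc (V y j t.2), ← (hUV x y s.1 i j t.2).eq]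
    simp only [mul_assoc]
  rw [h1, h2, ← mul_assoc, hU x y, mul_assoc, hV x y, mul_assoc]

lemma IsMonodromy.map {γ : ℂ} {T : ℂ → Matrix (Fin 2) (Fin 2) 𝒜} (hT : IsMonodromy γ T)
    (f : 𝒜 →ₐ[ℂ] ℬ) : IsMonodromy γ fun x => (T x).map f := by
  intro x y
  have h := congrArg f.mapMatrix (hT x y)
  rw [map_mul, map_mul] at h
  have e1 : f.mapMatrix ((rMatrix γ (x - y)).map (algebraMap ℂ 𝒜)) =
      (rMatrix γ (x - y)).map (algebraMap ℂ ℬ) := by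
    ext s t; simp
  have e2 : f.mapMatrix (tensorMul (T x) (T y)) = tensorMul ((T x).map f) ((T y).map f) := by
    ext s t; simp [tensorMul]
  have e3 : f.mapMatrix (tensorMulOp (T x) (T y)) =
      tensorMulOp ((T x).map f) ((T y).map f) := by
    ext s t; simp [tensorMulOp]
  rwa [e1, e2, e3] at h

lemma IsMonodromy.of_map {γ : ℂ} {T : ℂ → Matrix (Fin 2) (Fin 2) 𝒜} (e : 𝒜 ≃ₐ[ℂ] ℬ)
    (hT : IsMonodromy γ fun x => (T x).map e) : IsMonodromy γ T := by
  have h := IsMonodromy.map hT (e.symm : ℬ →ₐ[ℂ] 𝒜)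
  have h2 : (fun x => ((T x).map e).map (e.symm : ℬ →ₐ[ℂ] 𝒜)) = T := by
    funext x; ext p q; simp
  rwa [h2] at h

/-- The relation of `IsMonodromy` entry by entry. -/
lemma IsMonodromy.apply {γ : ℂ} {T : ℂ → Matrix (Fin 2) (Fin 2) 𝒜} (hT : IsMonodromy γ T)
    (x y : ℂ) (p q r s : Fin 2) :
    ∑ i, ∑ j, rMatrix γ (x - y) (p, q) (i, j) • (T x i r * T y j s) =
      ∑ i, ∑ j, rMatrix γ (x - y) (i, j) (r, s) • (T y q j * T x p i) := by
  have h := congrFun (congrFun (hT x y) (p, q)) (r, s)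
  simp only [Matrix.mul_apply, Fintype.sum_prod_type, tensorMul, tensorMulOp, Matrix.map_apply,
    ← Algebra.commutes, ← Algebra.smul_def] at h
  exact h

/-- The `L`-operator of one site, as a matrix in the auxiliary space. -/
noncomputable def siteOp (γ x : ℂ) : Matrix (Fin 2) (Fin 2) (Matrix (Fin 2) (Fin 2) ℂ) :=
  fun p q => fun s t => rMatrix γ x (p, s) (q, t)

/-- This is the Yang–Baxter equation for `R`. It depends only on differences, so `ν` is shifted away
and the entries are checked with the addition theorems. -/
lemma isMonodromy_siteOp (γ ν : ℂ) : IsMonodromy γ fun x => siteOp γ (x - ν) := by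
  intro x y
  obtain ⟨u, rfl⟩ : ∃ u, x = u + ν := ⟨x - ν, by ring⟩
  obtain ⟨v, rfl⟩ : ∃ v, y = v + ν := ⟨y - ν, by ring⟩
  have e : u + ν - (v + ν) = u - v := by ring
  simp only [add_sub_cancel_right, e]
  ext ⟨p, q⟩ ⟨r, s⟩ a b
  fin_cases p <;> fin_cases q <;> fin_cases r <;> fin_cases s <;>
  simp [Matrix.mul_apply, Fintype.sum_prod_type, tensorMul, tensorMulOp, siteOp, rMatrix,
    Algebra.algebraMap_eq_smul_one] <;>
  fin_cases a <;> fin_cases b <;> simp [wa, wb, wc, sinh_add, sinh_sub, cosh_sub] <;>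
  first | ring1 | (ring_nf; simp only [cosh_sq]; ring1) | (left; ring1)


section Relations

variable {γ : ℂ} {T : ℂ → Matrix (Fin 2) (Fin 2) 𝒜}

lemma IsMonodromy.C_mul_A (hT : IsMonodromy γ T) (x y : ℂ) :
    sinh (x - y) • (T x 1 0 * T y 0 0) =
      sinh (x - y + γ) • (T y 0 0 * T x 1 0) - sinh γ • (T x 0 0 * T y 1 0) := by
  have h := hT.apply x y 1 0 0 0
  simp [Fin.sum_univ_two, rMatrix, wa, wb, wc] at h
  rw [← h]; abel

lemma IsMonodromy.C_mul_D (hT : IsMonodromy γ T) (x y : ℂ) :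
    sinh (x - y + γ) • (T x 1 0 * T y 1 1) =
      sinh (x - y) • (T y 1 1 * T x 1 0) + sinh γ • (T y 1 0 * T x 1 1) := by
  have h := hT.apply x y 1 1 0 1
  simp [Fin.sum_univ_two, rMatrix, wa, wb, wc] at h
  rw [h]

lemma IsMonodromy.D_mul_B (hT : IsMonodromy γ T) (x y : ℂ) :
    sinh (x - y + γ) • (T y 1 1 * T x 0 1) =
      sinh (x - y) • (T x 0 1 * T y 1 1) + sinh γ • (T x 1 1 * T y 0 1) := by
  have h := hT.apply x y 0 1 1 1
  simp [Fin.sum_univ_two, rMatrix, wa, wb, wc] at h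
  rw [← h]

lemma IsMonodromy.A_mul_B (hT : IsMonodromy γ T) (x y : ℂ) :
    sinh (x - y) • (T y 0 0 * T x 0 1) =
      sinh (x - y + γ) • (T x 0 1 * T y 0 0) - sinh γ • (T y 0 1 * T x 0 0) := by
  have h := hT.apply x y 0 0 1 0
  simp [Fin.sum_univ_two, rMatrix, wa, wb, wc] at h
  rw [h]; abel

lemma IsMonodromy.C_mul_C (hT : IsMonodromy γ T) (x y : ℂ) :
    sinh (x - y + γ) • (T x 1 0 * T y 1 0) = sinh (x - y + γ) • (T y 1 0 * T x 1 0) := by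
  have h := hT.apply x y 1 1 0 0
  simpa [Fin.sum_univ_two, rMatrix, wa, wb, wc] using h

lemma IsMonodromy.B_mul_B (hT : IsMonodromy γ T) (x y : ℂ) :
    sinh (x - y + γ) • (T x 0 1 * T y 0 1) = sinh (x - y + γ) • (T y 0 1 * T x 0 1) := by
  have h := hT.apply x y 0 0 1 1
  simpa [Fin.sum_univ_two, rMatrix, wa, wb, wc] using h

/-- The exchange relation of `C` and `D`, solved for the products with `D` on the left: this is
`IsMonodromy.C_mul_A` with `-γ` for `γ`. -/
lemma exchange_neg {C D : ℂ → 𝒜} (h : ∀ x y, sinh (x - y + γ) • (C x * D y) =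
      sinh (x - y) • (D y * C x) + sinh γ • (C y * D x)) (x y : ℂ) (hxy : sinh (x - y) ≠ 0) :
    sinh (x - y) • (C x * D y) =
      sinh (x - y + -γ) • (D y * C x) - sinh (-γ) • (D x * C y) := by
  have h1 := h x y
  have h2 := h y x
  have e1 : sinh (y - x) = - sinh (x - y) := by rw [← sinh_neg]; ring_nf
  have e2 : sinh (y - x + γ) = - sinh (x - y + -γ) := by rw [← sinh_neg]; ring_nf
  have e3 : sinh (x - y) * sinh (x - y) =
      sinh (x - y + γ) * sinh (x - y + -γ) + sinh γ * sinh γ := by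
    simp only [sinh_add, sinh_neg, cosh_neg]
    linear_combination (sinh (x - y)) ^ 2 * (cosh_sq γ) * (-1) + sinh γ ^ 2 * cosh_sq (x - y)
  rw [e1, e2] at h2
  -- The relation for `(x, y)` and the one for `(y, x)` form a linear system. Eliminating `C y * D
  -- x` leaves the determinant `sinh (x - y) ^ 2`, computed in `e3`, and one power of it is
  -- cancelled.
  rw [← (smul_right_injective 𝒜 hxy).eq_iff]
  show sinh (x - y) • _ = sinh (x - y) • _
  rw [smul_smul, e3, sinh_neg]
  linear_combination (norm := module) sinh (x - y + -γ) • h1 - sinh γ • h2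

omit [Ring 𝒜] [Algebra ℂ 𝒜] in
lemma IsMonodromy.transpose_B_mul_D {ι : Type*} [Fintype ι] [DecidableEq ι]
    {T : ℂ → Matrix (Fin 2) (Fin 2) (Matrix ι ι ℂ)} (hT : IsMonodromy γ T) (x y : ℂ) :
    sinh (x - y + γ) • ((T x 0 1)ᵀ * (T y 1 1)ᵀ) =
      sinh (x - y) • ((T y 1 1)ᵀ * (T x 0 1)ᵀ) + sinh γ • ((T y 0 1)ᵀ * (T x 1 1)ᵀ) := by
  simpa only [transpose_mul, transpose_add, transpose_smul] using
    congrArg transpose (hT.D_mul_B x y)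

omit [Ring 𝒜] [Algebra ℂ 𝒜] in
lemma IsMonodromy.transpose_B_mul_A {ι : Type*} [Fintype ι] [DecidableEq ι]
    {T : ℂ → Matrix (Fin 2) (Fin 2) (Matrix ι ι ℂ)} (hT : IsMonodromy γ T) (x y : ℂ) :
    sinh (x - y) • ((T x 0 1)ᵀ * (T y 0 0)ᵀ) =
      sinh (x - y + γ) • ((T y 0 0)ᵀ * (T x 0 1)ᵀ) - sinh γ • ((T x 0 0)ᵀ * (T y 0 1)ᵀ) := by
  simpa only [transpose_mul, transpose_sub, transpose_smul] using
    congrArg transpose (hT.A_mul_B x y)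

end Relations

end RTT

/-! ### Extension by continuity across zeros of `sinh`. -/

section Dense

lemma countable_sinh_add_eq_zero (c : ℂ) : {x : ℂ | sinh (x + c) = 0}.Countable := by
  refine (Set.countable_range fun k : ℤ => -(k * Real.pi * I) - c).mono fun x hx => ?_
  have h : sin ((x + c) * I) = 0 := by rw [sin_mul_I, hx, zero_mul]
  obtain ⟨k, hk⟩ := sin_eq_zero_iff.1 h
  refine ⟨k, ?_⟩
  have : x + c = -(k * Real.pi * I) := by
    rw [← hk]; linear_combination (x + c) * I_mul_I
  simp only [← this]; ring

/-- Continuous functions with values in a Hausdorff space agree if they agree off the zeros of finitely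
many translates of `sinh`. -/
lemma eq_of_eq_of_sinh_ne_zero {κ E : Type*} [Countable κ] [TopologicalSpace E] [T2Space E]
    {f g : ℂ → E} (hf : Continuous f)
    (hg : Continuous g) (c : κ → ℂ) (h : ∀ x, (∀ k, sinh (x + c k) ≠ 0) → f x = g x) : f = g := by
  have hd : Dense (⋃ k, {x : ℂ | sinh (x + c k) = 0})ᶜ :=
    (Set.countable_iUnion fun k => countable_sinh_add_eq_zero (c k)).dense_compl ℂ
  refine Continuous.ext_on hd hf hg fun x hx => h x fun k hk => hx ?_
  exact Set.mem_iUnion.2 ⟨k, hk⟩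

variable {𝒜 : Type*} [Ring 𝒜] [Algebra ℂ 𝒜] [TopologicalSpace 𝒜] [ContinuousMul 𝒜] [T2Space 𝒜]
  {γ : ℂ} {T : ℂ → Matrix (Fin 2) (Fin 2) 𝒜}

/-- The RTT relation yields commutation only up to the scalar `sinh (x - y + γ)`. This is cancelled
where it is non-zero, and continuity in `x` covers the rest. -/
lemma IsMonodromy.commute_C (hT : IsMonodromy γ T) (hc : Continuous T) (x y : ℂ) :
    Commute (T x 1 0) (T y 1 0) := by
  have hc' : Continuous fun x => T x 1 0 := (continuous_apply_apply 1 0).comp hc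
  refine congrFun (eq_of_eq_of_sinh_ne_zero (f := fun x => T x 1 0 * T y 1 0)
    (g := fun x => T y 1 0 * T x 1 0) (hc'.mul continuous_const) (continuous_const.mul hc')
    (fun _ : Unit => -y + γ) fun x hx => ?_) x
  have hx' := hx ()
  rw [← add_assoc, ← sub_eq_add_neg] at hx'
  exact smul_right_injective _ hx' (hT.C_mul_C x y)

lemma IsMonodromy.commute_B (hT : IsMonodromy γ T) (hc : Continuous T) (x y : ℂ) :
    Commute (T x 0 1) (T y 0 1) := by
  have hc' : Continuous fun x => T x 0 1 := (continuous_apply_apply 0 1).comp hc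
  refine congrFun (eq_of_eq_of_sinh_ne_zero (f := fun x => T x 0 1 * T y 0 1)
    (g := fun x => T y 0 1 * T x 0 1) (hc'.mul continuous_const) (continuous_const.mul hc')
    (fun _ : Unit => -y + γ) fun x hx => ?_) x
  have hx' := hx ()
  rw [← add_assoc, ← sub_eq_add_neg] at hx'
  exact smul_right_injective _ hx' (hT.B_mul_B x y)

end Dense

/-! ### Ordered products of commuting operators. -/

section OrderedProduct

variable {M : Type*} [Monoid M]

/-- The ordered product `C(x₁) ⋯ C(x_n)`. -/
def opProd (C : ℂ → M) {n : ℕ} (x : Fin n → ℂ) : M := (List.ofFn fun i => C (x i)).prod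

variable (C : ℂ → M)

@[simp] lemma opProd_zero (x : Fin 0 → ℂ) : opProd C x = 1 := by simp [opProd]

lemma opProd_succ {n : ℕ} (x : Fin (n + 1) → ℂ) :
    opProd C x = C (x 0) * opProd C (fun i => x i.succ) := by
  simp [opProd, List.ofFn_succ]

lemma map_opProd {N F : Type*} [Monoid N] [FunLike F M N] [MonoidHomClass F M N] (f : F) {n : ℕ}
    (x : Fin n → ℂ) : f (opProd C x) = opProd (fun z => f (C z)) x := by
  simp [opProd, map_list_prod, List.map_ofFn, Function.comp_def]

lemma semiconjBy_opProd {C' : ℂ → M} {t : M} (h : ∀ z, SemiconjBy t (C z) (C' z)) {n : ℕ}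
    (x : Fin n → ℂ) : SemiconjBy t (opProd C x) (opProd C' x) := by
  induction n with
  | zero => simp
  | succ n ih => rw [opProd_succ, opProd_succ]; exact (h _).mul_right (ih _)

variable {C} (hC : ∀ z z', Commute (C z) (C z'))
include hC

lemma commute_opProd (z : ℂ) {n : ℕ} (x : Fin n → ℂ) : Commute (C z) (opProd C x) :=
  semiconjBy_opProd C (hC z) x

lemma opProd_succAbove {n : ℕ} (x : Fin (n + 1) → ℂ) (i : Fin (n + 1)) :
    opProd C x = opProd C (fun j => x (i.succAbove j)) * C (x i) := by
  induction n with
  | zero =>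
    obtain rfl : i = 0 := Fin.fin_one_eq_zero i
    simp [opProd_succ]
  | succ n ih =>
    refine Fin.cases ?_ (fun i => ?_) i
    · simp [opProd_succ C x, (commute_opProd hC (x 0) _).eq]
    · rw [opProd_succ C x, ih _ i, opProd_succ C (fun j => x (i.succ.succAbove j)), mul_assoc]
      simp

end OrderedProduct

/-! ### Algebraic Bethe ansatz for the dual states. -/

section Bra

variable {ι : Type*} [Fintype ι] [DecidableEq ι]

/-- The factor `sinh (x - y + γ) / sinh (x - y)` of the commutation relations. -/
noncomputable def exch (γ x y : ℂ) : ℂ := sinh (x - y + γ) / sinh (x - y)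

variable {γ : ℂ} {C A : ℂ → Matrix ι ι ℂ} {u : ι → ℂ} {α : ℂ → ℂ}
  (hC : ∀ z z', Commute (C z) (C z'))
  (hCA : ∀ x y, sinh (x - y) ≠ 0 → sinh (x - y) • (C x * A y) =
    sinh (x - y + γ) • (A y * C x) - sinh γ • (A x * C y))
  (hA : ∀ x, u ᵥ* A x = α x • u)

omit [DecidableEq ι] in
include hCA in
lemma mul_eq_exch_smul_sub {x y : ℂ} (h : sinh (x - y) ≠ 0) :
    C x * A y = exch γ x y • (A y * C x) - (sinh γ / sinh (x - y)) • (A x * C y) := by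
  rw [← (smul_right_injective _ h).eq_iff]
  simp only [exch, smul_sub, smul_smul, mul_div_cancel₀ _ h]
  exact hCA x y h

/-- Needed in `vecMul_opProd_mul`, where the bra lacking `C x` arises along two routes: directly
from `A y`, and through `A z` produced by exchanging `A y` with `C z`. -/
lemma exch_three_term {x y z : ℂ} (hxy : sinh (x - y) ≠ 0) (hzx : sinh (z - x) ≠ 0)
    (hzy : sinh (z - y) ≠ 0) :
    exch γ z y * (sinh γ / sinh (x - y)) - sinh γ / sinh (z - y) * (sinh γ / sinh (x - z)) =
      sinh γ / sinh (x - y) * exch γ z x := by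
  have e : sinh (x - z) = - sinh (z - x) := by rw [← sinh_neg]; ring_nf
  have e2 : x - y = (z - y) - (z - x) := by ring
  rw [exch, exch, e]
  generalize z - y = p at *
  generalize z - x = q at *
  field_simp
  rw [e2, sinh_sub, sinh_add, sinh_add]
  ring

lemma exch_three_term' {ν x z : ℂ} (hzx : sinh (z - x) ≠ 0) :
    sinh (z - ν + γ) - sinh (x - ν) * (sinh γ / sinh (x - z)) = sinh (z - ν) * exch γ z x := by
  have e : sinh (x - z) = - sinh (z - x) := by rw [← sinh_neg]; ring_nf
  have e2 : x - ν = (z - ν) - (z - x) := by ring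
  rw [exch, e, e2]
  generalize z - ν = p at *
  generalize z - x = q at *
  field_simp
  rw [sinh_sub, sinh_add, sinh_add]
  ring

include hC hCA hA

/-- The action of `A(y)` to the left on `⟨0| C(x₁) ⋯ C(x_n)`. -/
lemma vecMul_opProd_mul {n : ℕ} (x : Fin (n + 1) → ℂ) (y : ℂ)
    (hx : ∀ i j, i ≠ j → sinh (x i - x j) ≠ 0) (hy : ∀ i, sinh (x i - y) ≠ 0) :
    u ᵥ* (opProd C x * A y) = (α y * ∏ j, exch γ (x j) y) • (u ᵥ* opProd C x) -
      ∑ i, (sinh γ / sinh (x i - y) * α (x i) * ∏ j, exch γ (x (i.succAbove j)) (x i)) •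
        (u ᵥ* (opProd C (fun j => x (i.succAbove j)) * C y)) := by
  induction n generalizing y with
  | zero =>
    simp only [opProd_succ, opProd_zero, mul_one, one_mul, Fin.sum_univ_succ, Fin.prod_univ_succ,
      Finset.univ_eq_empty, Finset.prod_empty, Finset.sum_empty, add_zero]
    rw [mul_eq_exch_smul_sub hCA (hy 0)]
    simp only [vecMul_sub, vecMul_smul, ← vecMul_vecMul, hA, smul_vecMul, smul_smul]
    ring_nf
  | succ n ih =>
    have hz : ∀ i : Fin (n + 1), sinh (x i.succ - x 0) ≠ 0 := fun i => hx _ _ (Fin.succ_ne_zero i)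
    have hz' : ∀ i : Fin (n + 1), sinh (x 0 - x i.succ) ≠ 0 :=
      fun i => hx _ _ (Fin.succ_ne_zero i).symm
    have ih1 := ih (fun i => x i.succ) y
      (fun i j hij => hx _ _ fun h => hij (Fin.succ_injective _ h)) fun i => hy _
    have ih2 := ih (fun i => x i.succ) (x 0)
      (fun i j hij => hx _ _ fun h => hij (Fin.succ_injective _ h)) hz
    -- Commutativity places `C (x 0)` next to `A y`. Exchanging the two leaves `A y` or `A (x 0)`
    -- behind the remaining `C`, and the induction hypothesis applies to both.
    rw [opProd_succAbove hC x 0, mul_assoc, mul_eq_exch_smul_sub hCA (hy 0)]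
    simp only [mul_sub, Matrix.mul_smul, ← mul_assoc, Fin.zero_succAbove]
    rw [vecMul_sub, vecMul_smul, vecMul_smul, ← vecMul_vecMul, ← vecMul_vecMul u _ (C y), ih1, ih2]
    simp only [Matrix.sub_vecMul, smul_vecMul, Matrix.sum_vecMul, smul_sub, smul_smul,
      Finset.smul_sum, vecMul_vecMul]
    have e1 : ∀ i : Fin (n + 1), (opProd C fun j => x (i.succ.succAbove j)) =
        (opProd C fun j => x (i.succAbove j).succ) * C (x 0) := fun i => by
      rw [opProd_succAbove hC (fun j => x (i.succ.succAbove j)) 0]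
      simp
    have e2 : ∀ i : Fin (n + 1), (opProd C fun j => x (i.succAbove j).succ) * C y * C (x 0) =
        (opProd C fun j => x (i.succAbove j).succ) * C (x 0) * C y := fun i => by
      rw [mul_assoc, (hC _ _).eq, ← mul_assoc]
    have e3 : ∀ i : Fin (n + 1), ∏ j, exch γ (x (i.succ.succAbove j)) (x i.succ) =
        exch γ (x 0) (x i.succ) * ∏ j, exch γ (x (i.succAbove j).succ) (x i.succ) := fun i => by
      rw [Fin.prod_univ_succ]; simp
    rw [Fin.sum_univ_succ (n := n + 1), Fin.prod_univ_succ (n := n + 1)]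
    simp only [e1, e2, e3, Fin.zero_succAbove]
    have key : ∀ a b a' b' p q r : ι → ℂ, a = a' → b = b' → p = r + q →
        a - p - (b - q) = a' - (b' + r) := by
      rintro a b _ _ p q r rfl rfl rfl; abel
    refine key _ _ _ _ _ _ _ (by ring_nf) (by ring_nf) ?_
    · rw [← Finset.sum_add_distrib]
      refine Finset.sum_congr rfl fun i _ => ?_
      rw [← add_smul]
      congr 1
      linear_combination (α (x i.succ) * ∏ j, exch γ (x (i.succAbove j).succ) (x i.succ)) *
        exch_three_term (γ := γ) (hy i.succ) (hz' i) (hy 0)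

/-- The operator `C` of the chain with one more site of inhomogeneity `ν`, as a block matrix. -/
noncomputable def extC (γ ν κ : ℂ) (C A : ℂ → Matrix ι ι ℂ) (x : ℂ) :
    Matrix (Fin 2) (Fin 2) (Matrix ι ι ℂ) :=
  !![sinh (x - ν) • C x, κ • A x; 0, sinh (x - ν + γ) • C x]

omit hC hCA hA in
lemma opProd_extC_zero_zero (γ ν κ : ℂ) {n : ℕ} (x : Fin n → ℂ) :
    opProd (extC γ ν κ C A) x 0 0 = (∏ j, sinh (x j - ν)) • opProd C x ∧
      opProd (extC γ ν κ C A) x 1 0 = 0 := by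
  induction n with
  | zero => simp
  | succ n ih =>
    rw [opProd_succ, opProd_succ]
    simp [Matrix.mul_apply, extC, ih, Fin.prod_univ_succ, smul_smul, mul_comm]

/-- The component of `⟨0| C(x₁) ⋯ C(x_n)` with the additional site flipped. -/
lemma vecMul_opProd_extC {ν κ : ℂ}
    (hext : ∀ z z', Commute (extC γ ν κ C A z) (extC γ ν κ C A z')) {n : ℕ} (x : Fin (n + 1) → ℂ)
    (hx : ∀ i j, i ≠ j → sinh (x i - x j) ≠ 0) :
    u ᵥ* opProd (extC γ ν κ C A) x 0 1 =
      κ • ∑ i, (α (x i) * ∏ j, sinh (x (i.succAbove j) - ν) * exch γ (x (i.succAbove j)) (x i)) •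
        (u ᵥ* opProd C (fun j => x (i.succAbove j))) := by
  induction n with
  | zero =>
    have h1 : opProd (extC γ ν κ C A) x 0 1 = κ • A (x 0) := by
      simp [opProd_succ, extC]
    rw [h1, vecMul_smul, hA, Fin.sum_univ_succ]
    simp
  | succ n ih =>
    have hz' : ∀ i : Fin (n + 1), sinh (x 0 - x i.succ) ≠ 0 :=
      fun i => hx _ _ (Fin.succ_ne_zero i).symm
    have ih1 := ih (fun i => x i.succ)
      (fun i j hij => hx _ _ fun h => hij (Fin.succ_injective _ h))
    have hA1 := vecMul_opProd_mul hC hCA hA (fun i => x i.succ) (x 0)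
      (fun i j hij => hx _ _ fun h => hij (Fin.succ_injective _ h))
      (fun i => hx _ _ (Fin.succ_ne_zero i))
    have e1 : ∀ i : Fin (n + 1), (opProd C fun j => x (i.succ.succAbove j)) =
        (opProd C fun j => x (i.succAbove j).succ) * C (x 0) := fun i => by
      rw [opProd_succAbove hC (fun j => x (i.succ.succAbove j)) 0]
      simp
    have e3 : ∀ i : Fin (n + 1), ∏ j, sinh (x (i.succ.succAbove j) - ν) *
          exch γ (x (i.succ.succAbove j)) (x i.succ) =
        sinh (x 0 - ν) * exch γ (x 0) (x i.succ) *
          ∏ j, sinh (x (i.succAbove j).succ - ν) * exch γ (x (i.succAbove j).succ) (x i.succ) :=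
      fun i => by rw [Fin.prod_univ_succ]; simp
    -- With `C' (x 0)` moved to the right end, triangularity leaves two terms: the site is flipped
    -- by this factor, through `A (x 0)`, or already by the others. The first is expanded with
    -- `vecMul_opProd_mul`, the second by induction.
    rw [opProd_succAbove hext x 0]
    simp only [Fin.zero_succAbove]
    rw [Matrix.mul_apply, Fin.sum_univ_two, (opProd_extC_zero_zero γ ν κ _).1]
    have e4 : extC γ ν κ C A (x 0) 0 1 = κ • A (x 0) := rfl
    have e5 : extC γ ν κ C A (x 0) 1 1 = sinh (x 0 - ν + γ) • C (x 0) := rfl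
    rw [e4, e5, vecMul_add, smul_mul_assoc, mul_smul_comm, mul_smul_comm, vecMul_smul, vecMul_smul,
      vecMul_smul, ← vecMul_vecMul _ _ (C (x 0)), ih1, hA1, Fin.sum_univ_succ (n := n + 1)]
    simp only [e1, e3, Fin.zero_succAbove]
    simp only [smul_vecMul, Matrix.sum_vecMul, smul_sub, smul_add, smul_smul, Finset.smul_sum,
      vecMul_vecMul]
    have key : ∀ a a' p q r : ι → ℂ, a = a' → q = r + p →
        a - p + q = a' + r := by
      rintro a _ p q r rfl rfl; abel
    refine key _ _ _ _ _ ?_ ?_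
    · rw [Finset.prod_mul_distrib]; congr 1; ring
    · rw [← Finset.sum_add_distrib]
      refine Finset.sum_congr rfl fun i _ => ?_
      rw [← add_smul]
      congr 1
      rw [Fin.prod_univ_succAbove _ i, Finset.prod_mul_distrib]
      linear_combination (κ * α (x i.succ) * (∏ j, sinh (x (i.succAbove j).succ - ν)) *
        ∏ j, exch γ (x (i.succAbove j).succ) (x i.succ)) *
        exch_three_term' (γ := γ) (ν := ν) (hz' i)

end Bra

/-! ### Scalar products of a chain extended by one site with triangular `C` and `B`. -/

section Extension

variable {ι : Type*} [Fintype ι] [DecidableEq ι]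

/-- The transpose of a block matrix. -/
def blockTranspose (M : Matrix (Fin 2) (Fin 2) (Matrix ι ι ℂ)) :
    Matrix (Fin 2) (Fin 2) (Matrix ι ι ℂ) := fun p q => (M q p)ᵀ

omit [DecidableEq ι] in
lemma blockTranspose_mul (M N : Matrix (Fin 2) (Fin 2) (Matrix ι ι ℂ)) :
    blockTranspose (M * N) = blockTranspose N * blockTranspose M := by
  ext p q : 2
  simp [blockTranspose, Matrix.mul_apply, mul_comm]

/-- Transposition reverses the order of the factors, which is harmless because they commute. It
turns the action of `B` on kets into the action on bras studied above. -/
lemma blockTranspose_opProd {B : ℂ → Matrix (Fin 2) (Fin 2) (Matrix ι ι ℂ)}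
    (hB : ∀ z z', Commute (B z) (B z')) {n : ℕ} (y : Fin n → ℂ) :
    blockTranspose (opProd B y) = opProd (fun z => blockTranspose (B z)) y := by
  induction n with
  | zero =>
    ext p q : 2
    fin_cases p <;> fin_cases q <;> simp [blockTranspose, Matrix.one_apply, eq_comm]
  | succ n ih =>
    rw [opProd_succ, opProd_succ, (commute_opProd hB _ _).eq, blockTranspose_mul, ih]

omit [DecidableEq ι] in
lemma commute_blockTranspose {M N : Matrix (Fin 2) (Fin 2) (Matrix ι ι ℂ)} (h : M * N = N * M) :
    blockTranspose M * blockTranspose N = blockTranspose N * blockTranspose M := by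
  rw [← blockTranspose_mul, ← blockTranspose_mul, h]

lemma transpose_opProd {B : ℂ → Matrix ι ι ℂ}
    (hB : ∀ z z', Commute (B z) (B z')) {n : ℕ} (y : Fin n → ℂ) :
    (opProd B y)ᵀ = opProd (fun z => (B z)ᵀ) y := by
  induction n with
  | zero => simp
  | succ n ih =>
    rw [opProd_succ, opProd_succ, (commute_opProd hB _ _).eq, transpose_mul, ih]

omit [DecidableEq ι] in
lemma commute_transpose {M N : Matrix ι ι ℂ} (h : Commute M N) : Commute Mᵀ Nᵀ := by
  rw [Commute, SemiconjBy, ← transpose_mul, ← transpose_mul, h.eq]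

/-- The pairing `⟨0| C(x₁) ⋯ C(x_n) B(y₁) ⋯ B(y_m) |0⟩`. -/
def pairing (u : ι → ℂ) (C B : ℂ → Matrix ι ι ℂ) {n m : ℕ} (x : Fin n → ℂ) (y : Fin m → ℂ) : ℂ :=
  u ⬝ᵥ ((opProd C x * opProd B y) *ᵥ u)

/-- The pairing for a chain with one more site, where `C` and `B` are triangular. -/
lemma pairing_ext {γ₁ ν₁ γ₂ ν₂ κ : ℂ} {u : ι → ℂ} {C B A D : ℂ → Matrix ι ι ℂ} {α δ : ℂ → ℂ}
    {C' B' : ℂ → Matrix (Fin 2) (Fin 2) (Matrix ι ι ℂ)}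
    (hC : ∀ z z', Commute (C z) (C z')) (hB : ∀ z z', Commute (B z) (B z'))
    (hC' : ∀ z z', Commute (C' z) (C' z')) (hB' : ∀ z z', Commute (B' z) (B' z'))
    (hCA : ∀ x y, sinh (x - y) ≠ 0 → sinh (x - y) • (C x * A y) =
      sinh (x - y + γ₁) • (A y * C x) - sinh γ₁ • (A x * C y))
    (hBD : ∀ x y, sinh (x - y) ≠ 0 → sinh (x - y) • ((B x)ᵀ * (D y)ᵀ) =
      sinh (x - y + γ₂) • ((D y)ᵀ * (B x)ᵀ) - sinh γ₂ • ((D x)ᵀ * (B y)ᵀ))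
    (hA : ∀ x, u ᵥ* A x = α x • u) (hD : ∀ x, D x *ᵥ u = δ x • u)
    (eC : ∀ x, C' x = extC γ₁ ν₁ κ C A x)
    (eB : ∀ x, blockTranspose (B' x) = extC γ₂ ν₂ κ (fun z => (B z)ᵀ) (fun z => (D z)ᵀ) x)
    {n : ℕ} (x y : Fin (n + 1) → ℂ) (hx : ∀ i j, i ≠ j → sinh (x i - x j) ≠ 0)
    (hy : ∀ i j, i ≠ j → sinh (y i - y j) ≠ 0) :
    u ⬝ᵥ (((opProd C' x * opProd B' y) 0 0) *ᵥ u) =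
      (∏ j, sinh (x j - ν₁)) * (∏ j, sinh (y j - ν₂)) * pairing u C B x y +
      κ ^ 2 * ∑ i, ∑ k,
        (α (x i) * ∏ j, sinh (x (i.succAbove j) - ν₁) * exch γ₁ (x (i.succAbove j)) (x i)) *
        (δ (y k) * ∏ j, sinh (y (k.succAbove j) - ν₂) * exch γ₂ (y (k.succAbove j)) (y k)) *
        pairing u C B (fun j => x (i.succAbove j)) (fun j => y (k.succAbove j)) := by
  have eC' : C' = extC γ₁ ν₁ κ C A := funext eC
  have eB' : (fun z => blockTranspose (B' z)) =
    extC γ₂ ν₂ κ (fun z => (B z)ᵀ) (fun z => (D z)ᵀ) := funext eB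
  have hBt := fun z z' => commute_transpose (hB z z')
  have hBt' := fun z z' => commute_blockTranspose (hB' z z').eq
  have h01 : opProd C' x 0 0 = (∏ j, sinh (x j - ν₁)) • opProd C x := by
    rw [eC']; exact (opProd_extC_zero_zero γ₁ ν₁ κ x).1
  have h02 := vecMul_opProd_extC (κ := κ) (ν := ν₁) hC hCA hA (fun z z' => by
    rw [← eC, ← eC]; exact hC' z z') x hx
  rw [← eC'] at h02
  have h03 := blockTranspose_opProd hB' y
  rw [eB'] at h03
  have h04 : opProd B' y 0 0 = (∏ j, sinh (y j - ν₂)) • opProd B y := by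
    have h := congrFun (congrFun h03 0) 0
    rw [(opProd_extC_zero_zero γ₂ ν₂ κ y).1, ← transpose_opProd hB, ← transpose_smul] at h
    exact transpose_injective h
  have h05 : (opProd B' y 1 0) *ᵥ u = u ᵥ* opProd
      (extC γ₂ ν₂ κ (fun z => (B z)ᵀ) (fun z => (D z)ᵀ)) y 0 1 := by
    rw [← h03, blockTranspose, vecMul_transpose]
  have h06 := vecMul_opProd_extC (κ := κ) (ν := ν₂) (γ := γ₂) (α := δ) (u := u)
    (C := fun z => (B z)ᵀ) (A := fun z => (D z)ᵀ) hBt hBD (fun x => by rw [vecMul_transpose, hD]) (fun z z' => by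
      rw [← eB, ← eB]; exact hBt' z z') y hy
  rw [Matrix.mul_apply, Fin.sum_univ_two, add_mulVec, dotProduct_add, h01, h04, ← mulVec_mulVec u _
    (opProd B' y 1 0), dotProduct_mulVec u (opProd C' x 0 1), h02, h05, h06]
  congr 1
  · simp only [pairing, smul_mul_assoc, mul_smul_comm, smul_mulVec, dotProduct_smul, smul_eq_mul]
    ring
  · simp only [smul_dotProduct, dotProduct_smul, sum_dotProduct, dotProduct_sum, smul_eq_mul,
      Finset.mul_sum]
    rw [Finset.sum_comm]
    refine Finset.sum_congr rfl fun i _ => Finset.sum_congr rfl fun k _ => ?_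
    rw [pairing, ← mulVec_mulVec, dotProduct_mulVec, ← transpose_opProd hB, vecMul_transpose]
    ring

end Extension

/-! ### Left and right extensions of a highest weight representation, and their comparison. -/

section Vacuum

variable {ι : Type*} [Fintype ι] [DecidableEq ι]

/-- A monodromy matrix with a reference state `u`. -/
structure HighestWeight (γ : ℂ) (T : ℂ → Matrix (Fin 2) (Fin 2) (Matrix ι ι ℂ)) (u : ι → ℂ)
    (α δ : ℂ → ℂ) : Prop where
  isMonodromy : IsMonodromy γ T
  continuous : Continuous T
  vecMul_A : ∀ x, u ᵥ* T x 0 0 = α x • u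
  vecMul_D : ∀ x, u ᵥ* T x 1 1 = δ x • u
  vecMul_B : ∀ x, u ᵥ* T x 0 1 = 0
  A_mulVec : ∀ x, T x 0 0 *ᵥ u = α x • u
  D_mulVec : ∀ x, T x 1 1 *ᵥ u = δ x • u
  C_mulVec : ∀ x, T x 1 0 *ᵥ u = 0

/-- The `L`-operator of an additional site. -/
noncomputable def siteEmb (ι : Type*) [Fintype ι] [DecidableEq ι] (γ ν x : ℂ) :
    Matrix (Fin 2) (Fin 2) (Matrix (Fin 2) (Fin 2) (Matrix ι ι ℂ)) :=
  (siteOp γ (x - ν)).map (Algebra.ofId ℂ (Matrix ι ι ℂ)).mapMatrix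

/-- A monodromy matrix, acting trivially on an additional site. -/
def chainEmb (T : ℂ → Matrix (Fin 2) (Fin 2) (Matrix ι ι ℂ)) (x : ℂ) :
    Matrix (Fin 2) (Fin 2) (Matrix (Fin 2) (Fin 2) (Matrix ι ι ℂ)) :=
  (T x).map (Matrix.scalarAlgHom (Fin 2) ℂ)

variable (γ ν : ℂ) {T : ℂ → Matrix (Fin 2) (Fin 2) (Matrix ι ι ℂ)}

omit [DecidableEq ι] in
lemma siteEmb_apply [DecidableEq ι] (x : ℂ) (p q s t : Fin 2) :
    siteEmb ι γ ν x p q s t = rMatrix γ (x - ν) (p, s) (q, t) • 1 := by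
  simp [siteEmb, siteOp, Algebra.ofId_apply, Algebra.algebraMap_eq_smul_one]

lemma chainEmb_apply (x : ℂ) (p q s t : Fin 2) :
    chainEmb T x p q s t = if s = t then T x p q else 0 := by
  simp [chainEmb, Matrix.scalarAlgHom, Matrix.diagonal_apply]

lemma siteEmb_mul_chainEmb (x : ℂ) (p q s t : Fin 2) :
    (siteEmb ι γ ν x * chainEmb T x) p q s t =
      ∑ m, rMatrix γ (x - ν) (p, s) (m, t) • T x m q := by
  simp [Matrix.mul_apply, Matrix.sum_apply, siteEmb_apply, chainEmb_apply, -Fin.sum_univ_two,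
    -Matrix.smul_apply]

lemma chainEmb_mul_siteEmb (x : ℂ) (p q s t : Fin 2) :
    (chainEmb T x * siteEmb ι γ ν x) p q s t =
      ∑ m, rMatrix γ (x - ν) (m, s) (q, t) • T x p m := by
  simp [Matrix.mul_apply, Matrix.sum_apply, siteEmb_apply, chainEmb_apply, -Fin.sum_univ_two,
    -Matrix.smul_apply]

lemma commute_siteEmb_chainEmb (x y : ℂ) (p q r s : Fin 2) :
    Commute (siteEmb ι γ ν x p q) (chainEmb T y r s) := by
  rw [Commute, SemiconjBy]
  apply Matrix.ext
  intro a b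
  rw [Matrix.mul_apply, Matrix.mul_apply]
  simp only [siteEmb_apply, chainEmb_apply]
  simp [-Fin.sum_univ_two]

variable {γ}

lemma isMonodromy_left (hT : IsMonodromy γ T) :
    IsMonodromy γ fun x => siteEmb ι γ ν x * chainEmb T x :=
  ((isMonodromy_siteOp γ ν).map _).mul (hT.map _) (commute_siteEmb_chainEmb γ ν)

lemma isMonodromy_right (hT : IsMonodromy γ T) :
    IsMonodromy γ fun x => chainEmb T x * siteEmb ι γ ν x :=
  (hT.map _).mul ((isMonodromy_siteOp γ ν).map _)
    fun x y p q r s => (commute_siteEmb_chainEmb γ ν y x r s p q).symm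

/-- The additional site plays the part of the second auxiliary space in the RTT relation at `(x,
ν)`: `R(x - ν)` is then the `L`-operator of that site, and `T ν` acts on the site and the chain. -/
lemma left_mul_eq_mul_right (hT : IsMonodromy γ T) (x : ℂ) (p q : Fin 2) :
    SemiconjBy (T ν) ((chainEmb T x * siteEmb ι γ ν x) p q)
      ((siteEmb ι γ ν x * chainEmb T x) p q) := by
  rw [SemiconjBy]
  apply Matrix.ext
  intro s t
  have h := hT.apply x ν p s q t
  refine Matrix.mul_apply.trans (Eq.trans ?_ Matrix.mul_apply.symm)
  simp only [siteEmb_mul_chainEmb, chainEmb_mul_siteEmb, Finset.sum_mul, Finset.mul_sum,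
    smul_mul_assoc, mul_smul_comm]
  rw [Finset.sum_comm]
  refine Eq.trans ?_ (h.symm.trans ?_)
  · rfl
  · rw [Finset.sum_comm]

omit [DecidableEq ι] in
lemma continuous_rMatrix (γ ν : ℂ) (s t) : Continuous fun x => rMatrix γ (x - ν) s t := by
  unfold rMatrix wa wb wc
  split_ifs <;> fun_prop

lemma continuous_left (hT : Continuous T) : Continuous fun x => siteEmb ι γ ν x * chainEmb T x := by
  refine continuous_pi fun p => continuous_pi fun q => continuous_pi fun s => continuous_pi fun t => ?_
  simp only [siteEmb_mul_chainEmb]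
  refine continuous_finsetSum _ fun m _ => (continuous_rMatrix γ ν _ _).smul ?_
  exact (continuous_apply_apply m q).comp hT

lemma continuous_right (hT : Continuous T) :
    Continuous fun x => chainEmb T x * siteEmb ι γ ν x := by
  refine continuous_pi fun p => continuous_pi fun q => continuous_pi fun s => continuous_pi fun t => ?_
  simp only [chainEmb_mul_siteEmb]
  refine continuous_finsetSum _ fun m _ => (continuous_rMatrix γ ν _ _).smul ?_
  exact (continuous_apply_apply p m).comp hT

variable {u : ι → ℂ} {α δ : ℂ → ℂ}

/-- The coefficient of the partial pairing without `x_i` and `y_k` for one more site on the left. -/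
noncomputable def leftCoeff (γ ν : ℂ) (α δ : ℂ → ℂ) {n : ℕ} (x y : Fin (n + 1) → ℂ)
    (i k : Fin (n + 1)) : ℂ :=
  (α (x i) * ∏ j, sinh (x (i.succAbove j) - ν) * exch γ (x (i.succAbove j)) (x i)) *
    (δ (y k) * ∏ j, sinh (y (k.succAbove j) - ν + γ) * exch (-γ) (y (k.succAbove j)) (y k))

/-- The pairing of the chain with one more site on the left. -/
lemma HighestWeight.pairing_left (hT : HighestWeight γ T u α δ) {n : ℕ} (x y : Fin (n + 1) → ℂ)
    (hx : ∀ i j, i ≠ j → sinh (x i - x j) ≠ 0) (hy : ∀ i j, i ≠ j → sinh (y i - y j) ≠ 0) :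
    u ⬝ᵥ (((opProd (fun z => (siteEmb ι γ ν z * chainEmb T z) 1 0) x *
        opProd (fun z => (siteEmb ι γ ν z * chainEmb T z) 0 1) y) 0 0) *ᵥ u) =
      (∏ j, sinh (x j - ν)) * (∏ j, sinh (y j - ν + γ)) *
        pairing u (fun z => T z 1 0) (fun z => T z 0 1) x y +
      sinh γ ^ 2 * ∑ i, ∑ k, leftCoeff γ ν α δ x y i k *
        pairing u (fun z => T z 1 0) (fun z => T z 0 1)
          (fun j => x (i.succAbove j)) (fun j => y (k.succAbove j)) := by
  have hM := isMonodromy_left ν hT.isMonodromy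
  have hc := continuous_left (γ := γ) ν hT.continuous
  -- For `B` the diagonal weights appear in the opposite order, `a` before `b`. The parameters `(-γ,
  -- ν - γ)` produce this order, and `-γ` is also the sign in the exchange relation of `B` and `D`
  -- solved by `exchange_neg`.
  have h := pairing_ext (ν₁ := ν) (ν₂ := ν - γ) (κ := sinh γ) (γ₁ := γ) (γ₂ := -γ)
    (hT.isMonodromy.commute_C hT.continuous) (hT.isMonodromy.commute_B hT.continuous)
    (hM.commute_C hc) (hM.commute_B hc) (fun x y _ => hT.isMonodromy.C_mul_A x y)
    (D := fun z => T z 1 1) (δ := δ) (α := α) (u := u)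
    (exchange_neg hT.isMonodromy.transpose_B_mul_D) hT.vecMul_A hT.D_mulVec
    (fun x => by
      apply Matrix.ext
      intro p q
      simp only [siteEmb_mul_chainEmb, Fin.sum_univ_two]
      fin_cases p <;> fin_cases q <;> simp [rMatrix, extC, wa, wb, wc])
    (fun x => by
      apply Matrix.ext
      intro p q
      simp only [siteEmb_mul_chainEmb, blockTranspose, Fin.sum_univ_two]
      fin_cases p <;> fin_cases q <;>
        simp [rMatrix, extC, wa, wb, wc, sub_sub_eq_add_sub, sub_add_eq_add_sub]) x y hx hy
  simpa only [leftCoeff, sub_sub_eq_add_sub, sub_add_eq_add_sub] using h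

/-- The pairing of the chain with one more site on the right. -/
lemma HighestWeight.pairing_right (hT : HighestWeight γ T u α δ) {n : ℕ} (x y : Fin (n + 1) → ℂ)
    (hx : ∀ i j, i ≠ j → sinh (x i - x j) ≠ 0) (hy : ∀ i j, i ≠ j → sinh (y i - y j) ≠ 0) :
    u ⬝ᵥ (((opProd (fun z => (chainEmb T z * siteEmb ι γ ν z) 1 0) x *
        opProd (fun z => (chainEmb T z * siteEmb ι γ ν z) 0 1) y) 0 0) *ᵥ u) =
      (∏ j, sinh (x j - ν + γ)) * (∏ j, sinh (y j - ν)) *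
        pairing u (fun z => T z 1 0) (fun z => T z 0 1) x y +
      sinh γ ^ 2 * ∑ i, ∑ k, leftCoeff γ ν α δ y x k i *
        pairing u (fun z => T z 1 0) (fun z => T z 0 1)
          (fun j => x (i.succAbove j)) (fun j => y (k.succAbove j)) := by
  have hM := isMonodromy_right ν hT.isMonodromy
  have hc := continuous_right (γ := γ) ν hT.continuous
  have h := pairing_ext (ν₁ := ν - γ) (ν₂ := ν) (κ := sinh γ) (γ₁ := -γ) (γ₂ := γ)
    (hT.isMonodromy.commute_C hT.continuous) (hT.isMonodromy.commute_B hT.continuous)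
    (hM.commute_C hc) (hM.commute_B hc) (exchange_neg hT.isMonodromy.C_mul_D)
    (D := fun z => T z 0 0) (δ := α) (α := δ) (u := u)
    (fun x y _ => hT.isMonodromy.transpose_B_mul_A x y) hT.vecMul_D hT.A_mulVec
    (fun x => by
      apply Matrix.ext
      intro p q
      simp only [chainEmb_mul_siteEmb, Fin.sum_univ_two]
      fin_cases p <;> fin_cases q <;>
        simp [rMatrix, extC, wa, wb, wc, sub_sub_eq_add_sub, sub_add_eq_add_sub])
    (fun x => by
      apply Matrix.ext
      intro p q
      simp only [chainEmb_mul_siteEmb, blockTranspose, Fin.sum_univ_two]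
      fin_cases p <;> fin_cases q <;> simp [rMatrix, extC, wa, wb, wc]) x y hx hy
  simp only [sub_sub_eq_add_sub] at h
  simp only [leftCoeff, sub_add_eq_add_sub]
  rw [h]
  congr 2
  refine Finset.sum_congr rfl fun i _ => Finset.sum_congr rfl fun k _ => ?_
  ring

/-- Sandwich the intertwining relation between reference states. Both sides carry the same
eigenvalue `α ν`, which cancels. -/
lemma HighestWeight.left_eq_right (hT : HighestWeight γ T u α δ) (hν : α ν ≠ 0) {n : ℕ}
    (x y : Fin n → ℂ) :
    u ⬝ᵥ (((opProd (fun z => (siteEmb ι γ ν z * chainEmb T z) 1 0) x *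
        opProd (fun z => (siteEmb ι γ ν z * chainEmb T z) 0 1) y) 0 0) *ᵥ u) =
    u ⬝ᵥ (((opProd (fun z => (chainEmb T z * siteEmb ι γ ν z) 1 0) x *
        opProd (fun z => (chainEmb T z * siteEmb ι γ ν z) 0 1) y) 0 0) *ᵥ u) := by
  have h := (semiconjBy_opProd _ (fun z => left_mul_eq_mul_right ν hT.isMonodromy z 1 0) x).mul_right
    (semiconjBy_opProd _ (fun z => left_mul_eq_mul_right ν hT.isMonodromy z 0 1) y)
  revert h
  generalize opProd (fun z => (siteEmb ι γ ν z * chainEmb T z) 1 0) x *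
        opProd (fun z => (siteEmb ι γ ν z * chainEmb T z) 0 1) y = X
  generalize opProd (fun z => (chainEmb T z * siteEmb ι γ ν z) 1 0) x *
        opProd (fun z => (chainEmb T z * siteEmb ι γ ν z) 0 1) y = Y
  intro h
  -- In this block the off-diagonal contributions disappear, since `T ν 0 1` kills the bra and `T ν
  -- 1 0` kills the ket.
  have h0 : (T ν * Y) 0 0 = (X * T ν) 0 0 := congrFun (congrFun h.eq 0) 0
  rw [Matrix.mul_apply, Matrix.mul_apply, Fin.sum_univ_two, Fin.sum_univ_two] at h0
  have h1 := congrArg (fun M => u ⬝ᵥ (M *ᵥ u)) h0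
  simp only [add_mulVec, ← mulVec_mulVec, hT.A_mulVec, hT.C_mulVec, mulVec_zero, add_zero,
    mulVec_smul, dotProduct_add, dotProduct_mulVec u (T ν _ _), hT.vecMul_A, hT.vecMul_B,
    zero_dotProduct, smul_dotProduct, dotProduct_smul] at h1
  exact (smul_right_injective ℂ hν h1).symm

/-- The pairing in terms of partial pairings, for an arbitrary value of `ν`. -/
lemma HighestWeight.pairing_eq_sum (hT : HighestWeight γ T u α δ) {κ : Type*} [Countable κ]
    (c : κ → ℂ) (hα : ∀ z, (∀ k, sinh (z + c k) ≠ 0) → α z ≠ 0) {n : ℕ}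
    (x y : Fin (n + 1) → ℂ)
    (hx : ∀ i j, i ≠ j → sinh (x i - x j) ≠ 0) (hy : ∀ i j, i ≠ j → sinh (y i - y j) ≠ 0) :
    ((∏ j, sinh (x j - ν + γ)) * (∏ j, sinh (y j - ν)) -
      (∏ j, sinh (x j - ν)) * (∏ j, sinh (y j - ν + γ))) *
        pairing u (fun z => T z 1 0) (fun z => T z 0 1) x y =
      sinh γ ^ 2 * ∑ i, ∑ k, (leftCoeff γ ν α δ x y i k - leftCoeff γ ν α δ y x k i) *
        pairing u (fun z => T z 1 0) (fun z => T z 0 1)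
          (fun j => x (i.succAbove j)) (fun j => y (k.succAbove j)) := by
  set S := pairing u (fun z => T z 1 0) (fun z => T z 0 1) x y
  set S' := fun i k => pairing u (fun z => T z 1 0) (fun z => T z 0 1)
          (fun j => x (Fin.succAbove i j)) (fun j => y (Fin.succAbove k j))
  -- Both sides are continuous in `ν`, so it suffices to treat the values with `α ν ≠ 0`, where the
  -- left and right expansions may be equated.
  refine congrFun (eq_of_eq_of_sinh_ne_zero (E := ℂ)
    (f := fun ν => ((∏ j, sinh (x j - ν + γ)) * (∏ j, sinh (y j - ν)) -
      (∏ j, sinh (x j - ν)) * (∏ j, sinh (y j - ν + γ))) * S)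
    (g := fun ν => sinh γ ^ 2 * ∑ i, ∑ k,
      (leftCoeff γ ν α δ x y i k - leftCoeff γ ν α δ y x k i) * S' i k) ?_ ?_ c ?_) ν
  · fun_prop
  · unfold leftCoeff; fun_prop
  · intro ν hν
    have h1 := hT.pairing_left ν x y hx hy
    have h2 := hT.pairing_right ν x y hx hy
    have h3 := hT.left_eq_right ν (hα ν hν) x y
    simp only [S', sub_mul, Finset.sum_sub_distrib, mul_sub]
    linear_combination h1 - h2 - h3

end Vacuum

/-! ### The monodromy matrix of the chain as an iterated left extension. -/

section Chain

variable {L : ℕ}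

/-- Operators on a chain of `L + 1` sites as block matrices of operators on the last `L` sites. -/
noncomputable def splitFirst (L : ℕ) :
    QuantumOp (L + 1) ≃ₐ[ℂ] Matrix (Fin 2) (Fin 2) (QuantumOp L) :=
  (reindexAlgEquiv ℂ ℂ (Fin.consEquiv fun _ => Fin 2).symm).trans
    (compAlgEquiv (Fin 2) (Fin L → Fin 2) ℂ ℂ).symm

lemma splitFirst_apply (X : QuantumOp (L + 1)) (p q : Fin 2) (s t : Fin L → Fin 2) :
    splitFirst L X p q s t = X (Fin.cons p s) (Fin.cons q t) := rfl

lemma splitFirst_rLocal_zero (γ ν x : ℂ) (p q : Fin 2) :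
    splitFirst L (rLocal γ (x - ν) 0 p q) = siteEmb (Fin L → Fin 2) γ ν x p q := by
  ext a b s t
  rw [splitFirst_apply, siteEmb_apply]
  have h : (∀ k : Fin (L + 1), k ≠ 0 → (Fin.cons a s : Fin (L + 1) → Fin 2) k =
      (Fin.cons b t : Fin (L + 1) → Fin 2) k) ↔ s = t := by
    simp [Fin.forall_fin_succ, funext_iff]
  simp only [rLocal, h]
  by_cases hst : s = t <;> simp [hst]

lemma splitFirst_rLocal_succ (γ z : ℂ) (j : Fin L) (p q : Fin 2) :
    splitFirst L (rLocal γ z j.succ p q) =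
      Matrix.scalarAlgHom (Fin 2) ℂ (rLocal γ z j p q) := by
  ext a b s t
  rw [splitFirst_apply]
  have h : (∀ k : Fin (L + 1), k ≠ j.succ → (Fin.cons a s : Fin (L + 1) → Fin 2) k =
      (Fin.cons b t : Fin (L + 1) → Fin 2) k) ↔ (a = b ∧ ∀ k, k ≠ j → s k = t k) := by
    simp [Fin.forall_fin_succ, (Fin.succ_ne_zero j).symm]
  simp only [rLocal, h, Matrix.scalarAlgHom]
  by_cases hab : a = b <;> simp [hab, rLocal]

lemma map_splitFirst_monodromy (γ : ℂ) (μ : Fin (L + 1) → ℂ) (x : ℂ) :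
    (monodromy γ μ x).map (splitFirst L) =
      siteEmb (Fin L → Fin 2) γ (μ 0) x * chainEmb (monodromy γ fun j => μ j.succ) x := by
  have h : (monodromy γ μ x).map (splitFirst L) =
      (splitFirst L : QuantumOp (L + 1) →ₐ[ℂ] _).mapMatrix (monodromy γ μ x) := rfl
  have h2 : chainEmb (monodromy γ fun j => μ j.succ) x =
      (Matrix.scalarAlgHom (Fin 2) ℂ).mapMatrix (monodromy γ (fun j => μ j.succ) x) := rfl
  rw [h, h2, monodromy, monodromy, map_list_prod, map_list_prod, List.map_ofFn, List.map_ofFn,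
    List.ofFn_succ, List.prod_cons]
  congr 1
  · apply Matrix.ext
    intro p q
    exact splitFirst_rLocal_zero γ (μ 0) x p q
  · congr 2
    funext j
    apply Matrix.ext
    intro p q
    exact splitFirst_rLocal_succ γ _ j p q

lemma splitFirst_monodromy (γ : ℂ) (μ : Fin (L + 1) → ℂ) (x : ℂ) (p q : Fin 2) :
    splitFirst L (monodromy γ μ x p q) =
      (siteEmb (Fin L → Fin 2) γ (μ 0) x * chainEmb (monodromy γ fun j => μ j.succ) x) p q :=
  congrFun (congrFun (map_splitFirst_monodromy γ μ x) p) q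

lemma monodromy_cons (γ : ℂ) (μ : Fin (L + 1) → ℂ) (x : ℂ) (p q a b : Fin 2)
    (s t : Fin L → Fin 2) :
    monodromy γ μ x p q (Fin.cons a s) (Fin.cons b t) =
      ∑ m, rMatrix γ (x - μ 0) (p, a) (m, b) * monodromy γ (fun j => μ j.succ) x m q s t := by
  rw [← splitFirst_apply (monodromy γ μ x p q), splitFirst_monodromy, siteEmb_mul_chainEmb,
    Matrix.sum_apply]
  rfl

lemma monodromy_of_isEmpty (γ : ℂ) (μ : Fin 0 → ℂ) (x : ℂ) : monodromy γ μ x = 1 := by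
  simp [monodromy]

/-- Splitting off the first site identifies the monodromy with the left extension of a shorter
chain, so the RTT relation propagates by induction. -/
lemma isMonodromy_monodromy (γ : ℂ) (μ : Fin L → ℂ) : IsMonodromy γ (monodromy γ μ) := by
  induction L with
  | zero =>
    intro x y
    have h1 : tensorMul (1 : Matrix (Fin 2) (Fin 2) (QuantumOp 0)) 1 = 1 := by
      ext ⟨p, q⟩ ⟨r, s⟩ : 2
      fin_cases p <;> fin_cases q <;> fin_cases r <;> fin_cases s <;> simp [tensorMul]
    have h2 : tensorMulOp (1 : Matrix (Fin 2) (Fin 2) (QuantumOp 0)) 1 = 1 := by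
      ext ⟨p, q⟩ ⟨r, s⟩ : 2
      fin_cases p <;> fin_cases q <;> fin_cases r <;> fin_cases s <;> simp [tensorMulOp]
    rw [monodromy_of_isEmpty, monodromy_of_isEmpty, h1, h2, mul_one, one_mul]
  | succ L ih =>
    refine IsMonodromy.of_map (splitFirst L) ?_
    simp only [map_splitFirst_monodromy]
    exact isMonodromy_left _ (ih _)

lemma continuous_monodromy (γ : ℂ) (μ : Fin L → ℂ) : Continuous (monodromy γ μ) := by
  induction L with
  | zero =>
    have : monodromy γ μ = fun _ => 1 := funext (monodromy_of_isEmpty γ μ)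
    rw [this]; exact continuous_const
  | succ L ih =>
    refine continuous_pi fun p => continuous_pi fun q => continuous_pi fun s =>
      continuous_pi fun t => ?_
    rw [← Fin.cons_self_tail s, ← Fin.cons_self_tail t]
    simp only [monodromy_cons]
    refine continuous_finsetSum _ fun m _ => (continuous_rMatrix γ _ _ _).mul ?_
    exact (continuous_apply_apply _ _).comp ((continuous_apply_apply m q).comp (ih _))

lemma vacuum_cons (p : Fin 2) (s : Fin L → Fin 2) :
    vacuum (L + 1) (Fin.cons p s) = if p = 0 then vacuum L s else 0 := by
  have h : (Fin.cons p s : Fin (L + 1) → Fin 2) = (fun _ => 0) ↔ p = 0 ∧ s = fun _ => 0 := by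
    simp [funext_iff, Fin.forall_fin_succ]
  simp only [vacuum, Pi.single_apply, h]
  by_cases hp : p = 0 <;> simp [hp]

lemma vacuum_vecMul (X : QuantumOp L) : vacuum L ᵥ* X = X (fun _ => 0) := by
  simp [vacuum, Matrix.row]

lemma mulVec_vacuum (X : QuantumOp L) : X *ᵥ vacuum L = fun s => X s (fun _ => 0) := by
  ext; simp [vacuum]

lemma cons_zero_zero : (Fin.cons 0 (fun _ => 0) : Fin (L + 1) → Fin 2) = fun _ => 0 := by
  ext j; refine Fin.cases ?_ (fun j => ?_) j <;> simp

/-- The action of the monodromy matrix on the reference state from the right. -/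
lemma monodromy_apply_zero_left (γ : ℂ) (μ : Fin L → ℂ) (x : ℂ) (t : Fin L → Fin 2) :
    monodromy γ μ x 0 0 (fun _ => 0) t = (∏ j, wa γ (x - μ j)) * vacuum L t ∧
    monodromy γ μ x 1 1 (fun _ => 0) t = (∏ j, wb (x - μ j)) * vacuum L t ∧
    monodromy γ μ x 0 1 (fun _ => 0) t = 0 := by
  induction L with
  | zero =>
    obtain rfl : t = fun _ => 0 := Subsingleton.elim _ _
    simp [monodromy_of_isEmpty, vacuum]
  | succ L ih =>
    rw [← Fin.cons_self_tail t, ← cons_zero_zero]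
    obtain ⟨h1, h2, h3⟩ := ih (fun j => μ j.succ) (Fin.tail t)
    simp only [monodromy_cons, Fin.sum_univ_two, h1, h2, h3, vacuum_cons, Fin.prod_univ_succ]
    generalize t 0 = a
    fin_cases a <;> simp [rMatrix, mul_assoc]

lemma monodromy_apply_zero_right (γ : ℂ) (μ : Fin L → ℂ) (x : ℂ) (s : Fin L → Fin 2) :
    monodromy γ μ x 0 0 s (fun _ => 0) = (∏ j, wa γ (x - μ j)) * vacuum L s ∧
    monodromy γ μ x 1 1 s (fun _ => 0) = (∏ j, wb (x - μ j)) * vacuum L s ∧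
    monodromy γ μ x 1 0 s (fun _ => 0) = 0 := by
  induction L with
  | zero =>
    obtain rfl : s = fun _ => 0 := Subsingleton.elim _ _
    simp [monodromy_of_isEmpty, vacuum]
  | succ L ih =>
    rw [← Fin.cons_self_tail s, ← cons_zero_zero]
    obtain ⟨h1, h2, h3⟩ := ih (fun j => μ j.succ) (Fin.tail s)
    simp only [monodromy_cons, Fin.sum_univ_two, h1, h2, h3, vacuum_cons, Fin.prod_univ_succ]
    generalize s 0 = a
    fin_cases a <;> simp [rMatrix, mul_assoc]

lemma highestWeight_monodromy (γ : ℂ) (μ : Fin L → ℂ) :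
    HighestWeight γ (monodromy γ μ) (vacuum L) (fun x => ∏ j, wa γ (x - μ j))
      fun x => ∏ j, wb (x - μ j) where
  isMonodromy := isMonodromy_monodromy γ μ
  continuous := continuous_monodromy γ μ
  vecMul_A x := by
    rw [vacuum_vecMul]; ext t; exact (monodromy_apply_zero_left γ μ x t).1
  vecMul_D x := by
    rw [vacuum_vecMul]; ext t; exact (monodromy_apply_zero_left γ μ x t).2.1
  vecMul_B x := by
    rw [vacuum_vecMul]; ext t; exact (monodromy_apply_zero_left γ μ x t).2.2
  A_mulVec x := by
    rw [mulVec_vacuum]; ext t; exact (monodromy_apply_zero_right γ μ x t).1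
  D_mulVec x := by
    rw [mulVec_vacuum]; ext t; exact (monodromy_apply_zero_right γ μ x t).2.1
  C_mulVec x := by
    rw [mulVec_vacuum]; ext t; exact (monodromy_apply_zero_right γ μ x t).2.2

lemma scalarProduct_eq_pairing {n : ℕ} (γ : ℂ) (μ : Fin L → ℂ) (x y : Fin n → ℂ) :
    scalarProduct γ μ x y =
      pairing (vacuum L) (fun z => monodromy γ μ z 1 0) (fun z => monodromy γ μ z 0 1) x y := rfl

lemma vacuum_dotProduct_mulVec (X : QuantumOp L) :
    vacuum L ⬝ᵥ (X *ᵥ vacuum L) = X (fun _ => 0) (fun _ => 0) := by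
  rw [mulVec_vacuum]; simp [vacuum]

/-- The first site serves as the additional site with `ν = μ 0`. The reference state is unflipped
there, which selects the `(0, 0)` block. -/
lemma scalarProduct_succ {n : ℕ} (γ : ℂ) (μ : Fin (L + 1) → ℂ) (x y : Fin n → ℂ) :
    scalarProduct γ μ x y = vacuum L ⬝ᵥ
      (((opProd (fun z => (siteEmb (Fin L → Fin 2) γ (μ 0) z *
          chainEmb (monodromy γ fun j => μ j.succ) z) 1 0) x *
        opProd (fun z => (siteEmb (Fin L → Fin 2) γ (μ 0) z *
          chainEmb (monodromy γ fun j => μ j.succ) z) 0 1) y) 0 0) *ᵥ vacuum L) := by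
  simp only [← splitFirst_monodromy]
  rw [← map_opProd, ← map_opProd, ← map_mul, vacuum_dotProduct_mulVec, splitFirst_apply,
    scalarProduct_eq_pairing, pairing, vacuum_dotProduct_mulVec, cons_zero_zero]

end Chain

end SixVertex

namespace SixVertex

/-! ### The recursion in the number of sites and of arguments. -/

section Recursion

variable {L n : ℕ}

/-- The coefficient of the partial scalar product without `x_i` and `y_k`. -/
noncomputable def recursionCoeff (γ : ℂ) (μ : Fin (L + 1) → ℂ) (x y : Fin (n + 1) → ℂ)
    (i k : Fin (n + 1)) : ℂ :=
  (∏ j, wa γ (x (i.succAbove j) - μ 0) * wb (x (i.succAbove j) - μ 0) *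
      (wa γ (y (k.succAbove j) - μ 0) * wb (y (k.succAbove j) - μ 0))) *
    ((∏ j, wa γ (x i - μ j) * wb (y k - μ j)) *
        (∏ j, exch γ (x (i.succAbove j)) (x i) * exch (-γ) (y (k.succAbove j)) (y k)) -
      (∏ j, wb (x i - μ j) * wa γ (y k - μ j)) *
        ∏ j, exch (-γ) (x (i.succAbove j)) (x i) * exch γ (y (k.succAbove j)) (y k))

/-- Expanding the first site leaves a term with `S_n` of the shorter chain;
`HighestWeight.pairing_eq_sum` at `ν = μ 0` trades it for terms with one argument of each kind
removed. -/
lemma numerator_mul_scalarProduct (γ : ℂ) (μ : Fin (L + 1) → ℂ) (x y : Fin (n + 1) → ℂ)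
    (hx : ∀ i j, i ≠ j → sinh (x i - x j) ≠ 0) (hy : ∀ i j, i ≠ j → sinh (y i - y j) ≠ 0) :
    ((∏ j, wa γ (x j - μ 0) * wb (y j - μ 0)) - ∏ j, wa γ (y j - μ 0) * wb (x j - μ 0)) *
        scalarProduct γ μ x y =
      wc γ ^ 2 * ∑ i, ∑ k, recursionCoeff γ μ x y i k *
        scalarProduct γ (fun j => μ j.succ) (fun j => x (i.succAbove j))
          (fun j => y (k.succAbove j)) := by
  have hT := highestWeight_monodromy γ fun j => μ (Fin.succ j)
  have h1 := hT.pairing_left (μ 0) x y hx hy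
  have h2 := hT.pairing_eq_sum (μ 0) (fun j => -μ (Fin.succ j) + γ) (fun z hz => by
    refine Finset.prod_ne_zero_iff.2 fun j _ => ?_
    have := hz j
    rwa [← add_assoc, ← sub_eq_add_neg] at this) x y hx hy
  rw [← scalarProduct_succ, ← scalarProduct_eq_pairing] at h1
  rw [← scalarProduct_eq_pairing] at h2
  simp only [← scalarProduct_eq_pairing] at h1 h2
  have e : ∀ i k, recursionCoeff γ μ x y i k =
      (∏ j, wa γ (x j - μ 0) * wb (y j - μ 0)) *
        leftCoeff γ (μ 0) (fun x => ∏ j, wa γ (x - μ (Fin.succ j)))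
          (fun x => ∏ j, wb (x - μ (Fin.succ j))) x y i k -
      (∏ j, wa γ (y j - μ 0) * wb (x j - μ 0)) *
        leftCoeff γ (μ 0) (fun x => ∏ j, wa γ (x - μ (Fin.succ j)))
          (fun x => ∏ j, wb (x - μ (Fin.succ j))) y x k i := by
    intro i k
    simp only [recursionCoeff, leftCoeff, Finset.prod_mul_distrib, Fin.prod_univ_succ (n := L)]
    rw [Fin.prod_univ_succAbove _ i, Fin.prod_univ_succAbove _ k,
      Fin.prod_univ_succAbove (fun j => wa γ (y j - μ 0)) k,
      Fin.prod_univ_succAbove (fun j => wb (x j - μ 0)) i]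
    simp only [wa, wb]
    ring
  have e2 : ∀ i k, recursionCoeff γ μ x y i k *
      scalarProduct γ (fun j => μ j.succ) (fun j => x (i.succAbove j))
          (fun j => y (k.succAbove j)) = _ := fun i k => by rw [e]
  simp only [e2, sub_mul, Finset.sum_sub_distrib, mul_assoc, ← Finset.mul_sum, mul_sub] at h2 ⊢
  rw [h1]
  simp only [Finset.prod_mul_distrib, wa, wb, wc] at h2 ⊢
  -- The multiplier is the coefficient of `S_n` of the shorter chain in the left expansion, so this
  -- eliminates that scalar product.
  linear_combination (∏ j, sinh (x j - μ 0)) * (∏ j, sinh (y j - μ 0 + γ)) * h2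

end Recursion

/-! ### The scalar product as a sum over pairs of permutations. -/

section SumFormula

variable {L n : ℕ}

/-- The `i`-th factor of the kernel for arbitrary `v`. -/
noncomputable def offLevel (h : n ≤ L) (γ : ℂ) (μ : Fin L → ℂ) (w v : Fin n → ℂ) (i : Fin n) : ℂ :=
  wc γ ^ 2 *
    (∏ k ∈ Finset.Ioi i, wa γ (w k - μ (Fin.castLE h i)) * wb (w k - μ (Fin.castLE h i)) *
      (wa γ (v k - μ (Fin.castLE h i)) * wb (v k - μ (Fin.castLE h i)))) *
    (∏ k ∈ Finset.Ioi i, wb (w k - w i) * wb (v i - v k)) *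
    ((∏ k ∈ Finset.Ici (Fin.castLE h i), wa γ (w i - μ k) * wb (v i - μ k)) *
        (∏ k ∈ Finset.Ioi i, wa γ (w k - w i) * wa γ (v i - v k)) -
      (∏ k ∈ Finset.Ici (Fin.castLE h i), wb (w i - μ k) * wa γ (v i - μ k)) *
        (∏ k ∈ Finset.Ioi i, wa γ (w i - w k) * wa γ (v k - v i))) /
    numeratorR h γ μ w v i

/-- The kernel of the formula for arbitrary `v`. -/
noncomputable def offKernel (h : n ≤ L) (γ : ℂ) (μ : Fin L → ℂ) (w v : Fin n → ℂ) : ℂ :=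
  ∏ i, offLevel h γ μ w v i

/-- The product of the residues of `∏ⱼ 1 / b(z - p_j)` at the points `p_{σ i}`. -/
noncomputable def resWeight {m N : ℕ} (p : Fin N → ℂ) (σ : Fin m → Fin N) : ℂ :=
  ∏ i, (∏ j ∈ Finset.univ.erase (σ i), wb (p (σ i) - p j))⁻¹

lemma numeratorR_succ (h : n + 1 ≤ L + 1) (γ : ℂ) (μ : Fin (L + 1) → ℂ) (w v : Fin (n + 1) → ℂ)
    (i : Fin n) : numeratorR h γ μ w v i.succ =
      numeratorR (Nat.le_of_succ_le_succ h) γ (fun j => μ j.succ) (fun j => w j.succ)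
        (fun j => v j.succ) i := by
  simp only [numeratorR, Fin.prod_Ici_succ, Fin.castLE_succ]

lemma offLevel_succ (h : n + 1 ≤ L + 1) (γ : ℂ) (μ : Fin (L + 1) → ℂ) (w v : Fin (n + 1) → ℂ)
    (i : Fin n) : offLevel h γ μ w v i.succ =
      offLevel (Nat.le_of_succ_le_succ h) γ (fun j => μ j.succ) (fun j => w j.succ)
        (fun j => v j.succ) i := by
  simp only [offLevel, Fin.prod_Ici_succ, Fin.prod_Ioi_succ, Fin.castLE_succ, numeratorR_succ]

lemma offKernel_succ (h : n + 1 ≤ L + 1) (γ : ℂ) (μ : Fin (L + 1) → ℂ) (w v : Fin (n + 1) → ℂ) :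
    offKernel h γ μ w v = offLevel h γ μ w v 0 *
      offKernel (Nat.le_of_succ_le_succ h) γ (fun j => μ j.succ) (fun j => w j.succ)
        (fun j => v j.succ) := by
  simp only [offKernel, Fin.prod_univ_succ, offLevel_succ]

/-- The factors `b(w_k - w_i) b(v_i - v_k)` kill coinciding arguments, so sums over permutations
extend to sums over all maps, which is the shape that residues produce. -/
lemma offKernel_eq_zero (h : n ≤ L) (γ : ℂ) (μ : Fin L → ℂ) (w v : Fin n → ℂ)
    (hwv : ¬ (Function.Injective w ∧ Function.Injective v)) : offKernel h γ μ w v = 0 := by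
  have key : ∃ i k, i < k ∧ (w i = w k ∨ v i = v k) := by
    by_contra! hc
    refine hwv ⟨fun i k hik => ?_, fun i k hik => ?_⟩
    · by_contra hne
      rcases lt_or_gt_of_ne hne with hlt | hlt
      · exact (hc i k hlt).1 hik
      · exact (hc k i hlt).1 hik.symm
    · by_contra hne
      rcases lt_or_gt_of_ne hne with hlt | hlt
      · exact (hc i k hlt).2 hik
      · exact (hc k i hlt).2 hik.symm
  obtain ⟨i, k, hik, he⟩ := key
  refine Finset.prod_eq_zero (Finset.mem_univ i) ?_
  have : ∏ k ∈ Finset.Ioi i, wb (w k - w i) * wb (v i - v k) = 0 := by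
    refine Finset.prod_eq_zero (Finset.mem_Ioi.2 hik) ?_
    rcases he with he | he <;> simp [he, wb]
  rw [offLevel, this]
  simp

/-- A sum over maps that is supported on injective maps, split according to the first value. -/
lemma sum_fun_succ {E : Type*} [AddCommMonoid E] (f : (Fin (n + 1) → Fin (n + 1)) → E)
    (hf : ∀ σ, ¬ Function.Injective σ → f σ = 0) :
    ∑ σ, f σ = ∑ i, ∑ σ : Fin n → Fin n, f (Fin.cons i fun j => i.succAbove (σ j)) := by
  rw [← (Fin.consEquiv fun _ => Fin (n + 1)).sum_comp, Fintype.sum_prod_type]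
  refine Finset.sum_congr rfl fun i _ => ?_
  symm
  refine Finset.sum_of_injOn (fun σ j => i.succAbove (σ j)) ?_ (by simp) ?_ fun σ _ => rfl
  · intro σ _ σ' _ hσ
    funext j
    exact Fin.succAbove_right_injective (congrFun hσ j)
  · intro σ _ hσ
    refine hf _ fun hinj => hσ ?_
    have hne : ∀ j, σ j ≠ i := fun j hj => by
      have := @hinj j.succ 0 (by simpa using hj)
      exact Fin.succ_ne_zero _ this
    choose σ' hσ' using fun j => Fin.exists_succAbove_eq (hne j)
    exact ⟨σ', by simp, funext hσ'⟩

/-- A pair of points contributes `1 / b` in both orders. Splitting off the first point collects all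
pairs that contain it; one order is cancelled by the factors in `offLevel`, the other becomes the
denominator of `exch`. -/
lemma resWeight_cons (p : Fin (n + 1) → ℂ) (i : Fin (n + 1)) (σ : Fin n → Fin n) :
    resWeight p (Fin.cons i fun j => i.succAbove (σ j) : Fin (n + 1) → Fin (n + 1)) =
      (∏ j, wb (p i - p (i.succAbove j)))⁻¹ * (∏ j, wb (p (i.succAbove (σ j)) - p i))⁻¹ *
        resWeight (fun j => p (i.succAbove j)) σ := by
  have h1 : ∀ (f : Fin (n + 1) → ℂ) (i : Fin (n + 1)),
      ∏ j ∈ Finset.univ.erase i, f j = ∏ j, f (i.succAbove j) := by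
    intro f i
    rw [← Finset.compl_singleton, ← Fin.image_succAbove_univ,
      Finset.prod_image fun _ _ _ _ h => Fin.succAbove_right_injective h]
  have h2 : ∀ j, ∏ k ∈ Finset.univ.erase (i.succAbove j), wb (p (i.succAbove j) - p k) =
      wb (p (i.succAbove j) - p i) *
        ∏ k ∈ Finset.univ.erase j, wb (p (i.succAbove j) - p (i.succAbove k)) := by
    intro j
    have he : Finset.univ.erase (i.succAbove j) =
        insert i ((Finset.univ.erase j).image i.succAbove) := by
      ext k
      rcases Fin.eq_self_or_eq_succAbove i k with rfl | ⟨k, rfl⟩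
      · simp [Fin.ne_succAbove]
      · simp [Fin.succAbove_ne]
    rw [he, Finset.prod_insert (by simp [Fin.succAbove_ne]),
      Finset.prod_image fun _ _ _ _ h => Fin.succAbove_right_injective h]
  rw [resWeight, Fin.prod_univ_succ]
  simp only [Fin.cons_zero, Fin.cons_succ, h1 _ i, h2, mul_inv, Finset.prod_mul_distrib, resWeight,
    Finset.prod_inv_distrib, mul_assoc]

lemma prod_comp_injective {M : Type*} [CommMonoid M] {σ : Fin n → Fin n}
    (hσ : Function.Injective σ) (f : Fin n → M) : ∏ j, f (σ j) = ∏ j, f j :=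
  (Finite.injective_iff_bijective.1 hσ).prod_comp f

lemma cons_succAbove_injective {σ : Fin n → Fin n} (hσ : Function.Injective σ) (i : Fin (n + 1)) :
    Function.Injective (Fin.cons i fun j => i.succAbove (σ j) : Fin (n + 1) → Fin (n + 1)) := by
  rw [Fin.cons_injective_iff]
  refine ⟨?_, Fin.succAbove_right_injective.comp hσ⟩
  rintro ⟨j, hj⟩
  exact Fin.succAbove_ne i _ hj

lemma wb_sub_comm (x y : ℂ) : wb (x - y) = -wb (y - x) := by
  rw [wb, wb, ← sinh_neg, neg_sub]

lemma exch_eq (γ x y : ℂ) : exch γ x y = wa γ (x - y) / wb (x - y) := rfl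

/-- Changing the sign of `γ` amounts to exchanging the arguments, since `sinh` is odd. -/
lemma exch_neg_eq (γ x y : ℂ) : exch (-γ) x y = wa γ (y - x) / wb (y - x) := by
  have e : x - y + -γ = -(y - x + γ) := by ring
  rw [exch, e, sinh_neg, wa, ← neg_sub y x, sinh_neg, neg_div_neg_eq, wb]

/-- The first factor of the kernel, with its residues, is the coefficient of the recursion. -/
lemma offLevel_zero_mul (h : n + 1 ≤ L + 1) (γ : ℂ) (μ : Fin (L + 1) → ℂ) (x y : Fin (n + 1) → ℂ)
    (hx : ∀ i j, i ≠ j → sinh (x i - x j) ≠ 0) (hy : ∀ i j, i ≠ j → sinh (y i - y j) ≠ 0)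
    (i k : Fin (n + 1)) {σ τ : Fin n → Fin n} (hσ : Function.Injective σ)
    (hτ : Function.Injective τ) :
    offLevel h γ μ (x ∘ (Fin.cons i fun j => i.succAbove (σ j) : Fin (n + 1) → Fin (n + 1)))
        (y ∘ (Fin.cons k fun j => k.succAbove (τ j) : Fin (n + 1) → Fin (n + 1))) 0 *
      ((∏ j, wb (x i - x (i.succAbove j)))⁻¹ * (∏ j, wb (x (i.succAbove (σ j)) - x i))⁻¹ *
      ((∏ j, wb (y k - y (k.succAbove j)))⁻¹ * (∏ j, wb (y (k.succAbove (τ j)) - y k))⁻¹)) =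
    wc γ ^ 2 * recursionCoeff γ μ x y i k /
      ((∏ j, wa γ (x j - μ 0) * wb (y j - μ 0)) - ∏ j, wa γ (y j - μ 0) * wb (x j - μ 0)) := by
  have hN : numeratorR h γ μ
        (x ∘ (Fin.cons i fun j => i.succAbove (σ j) : Fin (n + 1) → Fin (n + 1)))
        (y ∘ (Fin.cons k fun j => k.succAbove (τ j) : Fin (n + 1) → Fin (n + 1))) 0 =
      (∏ j, wa γ (x j - μ 0) * wb (y j - μ 0)) - ∏ j, wa γ (y j - μ 0) * wb (x j - μ 0) := by
    have e : Finset.Ici (0 : Fin (n + 1)) = Finset.univ := by ext; simp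
    simp only [numeratorR, e, Fin.castLE_zero, Function.comp_apply, Finset.prod_mul_distrib]
    rw [prod_comp_injective (cons_succAbove_injective hσ i) fun j => wa γ (x j - μ 0),
      prod_comp_injective (cons_succAbove_injective hτ k) fun j => wb (y j - μ 0),
      prod_comp_injective (cons_succAbove_injective hσ i) fun j => wb (x j - μ 0),
      prod_comp_injective (cons_succAbove_injective hτ k) fun j => wa γ (y j - μ 0)]
  have e : Finset.Ici (0 : Fin (L + 1)) = Finset.univ := by ext; simp
  have hb1 : ∏ j, wb (x (i.succAbove j) - x i) ≠ 0 :=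
    Finset.prod_ne_zero_iff.2 fun j _ => hx _ _ (Fin.succAbove_ne i j)
  have hb2 : ∏ j, wb (y k - y (k.succAbove j)) ≠ 0 :=
    Finset.prod_ne_zero_iff.2 fun j _ => hy _ _ (Fin.succAbove_ne k j).symm
  have hs : (∏ _j : Fin n, (-1 : ℂ)) * ∏ _j : Fin n, (-1 : ℂ) = 1 := by
    rw [← Finset.prod_mul_distrib]; simp
  have e1 : ∏ j, wb (x i - x (i.succAbove j)) =
      (∏ _j : Fin n, (-1 : ℂ)) * ∏ j, wb (x (i.succAbove j) - x i) := by
    rw [← Finset.prod_mul_distrib]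
    exact Finset.prod_congr rfl fun j _ => by rw [wb_sub_comm]; ring
  have e2 : ∏ j, wb (y (k.succAbove j) - y k) =
      (∏ _j : Fin n, (-1 : ℂ)) * ∏ j, wb (y k - y (k.succAbove j)) := by
    rw [← Finset.prod_mul_distrib]
    exact Finset.prod_congr rfl fun j _ => by rw [wb_sub_comm]; ring
  rw [offLevel, hN]
  simp only [Fin.prod_Ioi_zero, Function.comp_apply, Fin.cons_zero, Fin.cons_succ, e,
    Fin.castLE_zero, Finset.prod_mul_distrib, recursionCoeff, exch_neg_eq]
  simp only [exch_eq, Finset.prod_div_distrib]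
  rw [prod_comp_injective hσ fun j => wa γ (x (i.succAbove j) - μ 0),
    prod_comp_injective hσ fun j => wb (x (i.succAbove j) - μ 0),
    prod_comp_injective hτ fun j => wa γ (y (k.succAbove j) - μ 0),
    prod_comp_injective hτ fun j => wb (y (k.succAbove j) - μ 0),
    prod_comp_injective hσ fun j => wb (x (i.succAbove j) - x i),
    prod_comp_injective hτ fun j => wb (y k - y (k.succAbove j)),
    prod_comp_injective hσ fun j => wa γ (x (i.succAbove j) - x i),
    prod_comp_injective hτ fun j => wa γ (y k - y (k.succAbove j)),
    prod_comp_injective hσ fun j => wa γ (x i - x (i.succAbove j)),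
    prod_comp_injective hτ fun j => wa γ (y (k.succAbove j) - y k),
    prod_comp_injective hτ fun j => wb (y (k.succAbove j) - y k), e1, e2]
  have hs0 : (∏ _j : Fin n, (-1 : ℂ)) ≠ 0 := left_ne_zero_of_mul_eq_one hs
  generalize (∏ _j : Fin n, (-1 : ℂ)) = s at *
  generalize ∏ j, wb (x (i.succAbove j) - x i) = p at *
  generalize ∏ j, wb (y k - y (k.succAbove j)) = q at *
  have hs2 : s ^ 2 = 1 := by rw [sq, hs]
  field_simp
  simp only [hs2]
  ring

/-- The scalar product as a sum over residues. -/
theorem scalarProduct_eq_sum (h : n ≤ L) (γ : ℂ) (μ : Fin L → ℂ) (x y : Fin n → ℂ)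
    (hx : ∀ i j, i ≠ j → sinh (x i - x j) ≠ 0) (hy : ∀ i j, i ≠ j → sinh (y i - y j) ≠ 0)
    (hN : ∀ σ τ : Fin n → Fin n, Function.Injective σ → Function.Injective τ →
      ∀ i, numeratorR h γ μ (x ∘ σ) (y ∘ τ) i ≠ 0) :
    scalarProduct γ μ x y = ∑ σ : Fin n → Fin n, ∑ τ : Fin n → Fin n,
      offKernel h γ μ (x ∘ σ) (y ∘ τ) * (resWeight x σ * resWeight y τ) := by
  induction n generalizing L with
  | zero =>
    rw [scalarProduct_eq_pairing, pairing, vacuum_dotProduct_mulVec]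
    simp [offKernel, resWeight]
  | succ n ih =>
    obtain ⟨L, rfl⟩ : ∃ L', L = L' + 1 := ⟨L - 1, by omega⟩
    have h0 : ∀ σ τ : Fin (n + 1) → Fin (n + 1), ¬ (Function.Injective σ ∧ Function.Injective τ) →
        offKernel h γ μ (x ∘ σ) (y ∘ τ) * (resWeight x σ * resWeight y τ) = 0 := fun σ τ hστ => by
      rw [offKernel_eq_zero, zero_mul]
      exact fun hh => hστ ⟨hh.1.of_comp, hh.2.of_comp⟩
    rw [sum_fun_succ _ fun σ hσ => Finset.sum_eq_zero fun τ _ => h0 σ τ fun hh => hσ hh.1]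
    have h1 : ∀ (i : Fin (n + 1)) (σ : Fin n → Fin n), _ = _ := fun i σ =>
      sum_fun_succ (fun τ : Fin (n + 1) → Fin (n + 1) =>
        offKernel h γ μ (x ∘ (Fin.cons i fun j => i.succAbove (σ j) : Fin (n + 1) → Fin (n + 1)))
          (y ∘ τ) * (resWeight x (Fin.cons i fun j => i.succAbove (σ j) : Fin (n + 1) → Fin (n + 1))
            * resWeight y τ))
        fun τ hτ => h0 _ _ fun hh => hτ hh.2
    simp only [h1]
    -- At level `0` the numerator involves all arguments symmetrically, so the value for the
    -- identity serves for every pair of permutations.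
    have hN0 := hN id id Function.injective_id Function.injective_id 0
    have eI : Finset.Ici (0 : Fin (n + 1)) = Finset.univ := by ext; simp
    simp only [numeratorR, eI, Fin.castLE_zero, Function.comp_id] at hN0
    refine mul_left_cancel₀ hN0 ?_
    rw [numerator_mul_scalarProduct γ μ x y hx hy, Finset.mul_sum, Finset.mul_sum]
    refine Finset.sum_congr rfl fun i _ => ?_
    rw [Finset.sum_comm, Finset.mul_sum, Finset.mul_sum]
    refine Finset.sum_congr rfl fun k _ => ?_
    have hih := ih (Nat.le_of_succ_le_succ h) (fun j => μ j.succ) (fun j => x (i.succAbove j))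
      (fun j => y (k.succAbove j))
      (fun a b hab => hx _ _ fun he => hab (Fin.succAbove_right_injective he))
      (fun a b hab => hy _ _ fun he => hab (Fin.succAbove_right_injective he))
      (fun σ τ hσ hτ a => by
        have := hN _ _ (cons_succAbove_injective hσ i) (cons_succAbove_injective hτ k) a.succ
        rw [numeratorR_succ] at this
        simpa [Function.comp_def] using this)
    rw [hih]
    simp only [Finset.mul_sum]
    refine Finset.sum_congr rfl fun σ _ => Finset.sum_congr rfl fun τ _ => ?_
    rw [offKernel_succ, resWeight_cons, resWeight_cons]
    simp only [Function.comp_apply, Fin.cons_succ]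
    -- For permutations the level-`0` factor with its residues is the recursion coefficient;
    -- otherwise the kernel of the remaining levels vanishes on both sides.
    by_cases hστ : Function.Injective σ ∧ Function.Injective τ
    · have hz := offLevel_zero_mul h γ μ x y hx hy i k hστ.1 hστ.2
      rw [eq_div_iff hN0] at hz
      simp only [Function.comp_def]
      simp only [Function.comp_def] at hz
      linear_combination (-(offKernel (Nat.le_of_succ_le_succ h) γ (fun j => μ j.succ)
        (fun j => x (i.succAbove (σ j))) (fun j => y (k.succAbove (τ j))) *
          (resWeight (fun j => x (i.succAbove j)) σ * resWeight (fun j => y (k.succAbove j)) τ))) * hz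
    · have hz : offKernel (Nat.le_of_succ_le_succ h) γ (fun j => μ j.succ)
          (fun j => x (i.succAbove (σ j))) (fun j => y (k.succAbove (τ j))) = 0 :=
        offKernel_eq_zero _ _ _ _ _ fun hh => hστ
          ⟨Function.Injective.of_comp (f := fun j => x (i.succAbove j)) hh.1,
            Function.Injective.of_comp (f := fun j => y (k.succAbove j)) hh.2⟩
      simp only [Function.comp_def, hz, zero_mul, mul_zero]

end SumFormula

/-! ### Triangular products and signs. -/

section Products

variable {M : Type*} [CommMonoid M] {L n : ℕ}

lemma prod_Iio_castLE (h : n ≤ L) (i : Fin n) (f : Fin L → M) :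
    ∏ k ∈ Finset.Iio (Fin.castLE h i), f k = ∏ k ∈ Finset.Iio i, f (Fin.castLE h k) := by
  symm
  refine Finset.prod_nbij (Fin.castLE h) ?_ (fun a _ b _ hab => Fin.castLE_injective h hab) ?_
    fun _ _ => rfl
  · intro k hk
    have hk' : k < i := Finset.mem_Iio.1 hk
    exact Finset.mem_Iio.2 hk'
  · intro k hk
    have hk' : k < Fin.castLE h i := Finset.mem_Iio.1 (Finset.mem_coe.1 hk)
    have hk'' : (⟨k, lt_trans hk' i.2⟩ : Fin n) < i := hk'
    exact ⟨⟨k, lt_trans hk' i.2⟩, Finset.mem_coe.2 (Finset.mem_Iio.2 hk''), rfl⟩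

lemma prod_Iio_mul_prod_Ici (i : Fin n) (f : Fin n → M) :
    (∏ k ∈ Finset.Iio i, f k) * ∏ k ∈ Finset.Ici i, f k = ∏ k, f k := by
  rw [← Finset.prod_union (Finset.disjoint_left.2 fun k hk hk' => by
    simp only [Finset.mem_Iio, Finset.mem_Ici] at hk hk'; exact absurd hk (not_lt.2 hk'))]
  refine Finset.prod_congr ?_ fun _ _ => rfl
  ext k; simpa using lt_or_ge k i

lemma prod_Iio_mul_prod_Ioi (i : Fin n) (f : Fin n → M) :
    (∏ k ∈ Finset.Iio i, f k) * ∏ k ∈ Finset.Ioi i, f k = ∏ k ∈ Finset.univ.erase i, f k := by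
  rw [← Finset.prod_union (Finset.disjoint_left.2 fun k hk hk' => by
    simp only [Finset.mem_Iio, Finset.mem_Ioi] at hk hk'; exact absurd hk (not_lt.2 hk'.le))]
  refine Finset.prod_congr ?_ fun _ _ => rfl
  ext k; simp

lemma prod_prod_Iio_comm (f : Fin n → Fin n → M) :
    ∏ i, ∏ k ∈ Finset.Iio i, f i k = ∏ i, ∏ k ∈ Finset.Ioi i, f k i := by
  refine Finset.prod_comm' ?_
  intro i k; simp

lemma neg_one_pow_mul_prod_Ioi :
    (-1 : ℂ) ^ (n * (n + 1) / 2) * ∏ i : Fin n, ∏ _k ∈ Finset.Ioi i, (-1 : ℂ) = (-1) ^ n := by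
  induction n with
  | zero => simp
  | succ n ih =>
    rw [Fin.prod_univ_succ, Fin.prod_Ioi_zero]
    simp only [Fin.prod_Ioi_succ]
    have e : (n + 1) * (n + 1 + 1) / 2 = n * (n + 1) / 2 + (n + 1) := by
      rw [← Nat.add_mul_div_right _ _ two_pos]; ring_nf
    rw [e, pow_add, pow_succ (-1 : ℂ) n, Finset.prod_const, Finset.card_univ, Fintype.card_fin]
    have hs : ((-1 : ℂ) ^ n) ^ 2 = 1 := by rw [← pow_mul, mul_comm, pow_mul]; simp
    linear_combination (-1 * (-1 : ℂ) ^ n * (-1) ^ n) * ih + (-1 : ℂ) ^ n * hs * (-1)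

end Products

/-! ### The kernel on shell: removal of apparent singularities and use of the Bethe equations. -/

section OnShell

variable {L n : ℕ} (h : n ≤ L) (γ φ₁ φ₂ : ℂ) (μ : Fin L → ℂ) (w v : Fin n → ℂ)

/-- `Λ_i` times its denominators. -/
noncomputable def regLambda (i : Fin n) : ℂ :=
  (-1) ^ n * ((∏ k ∈ Finset.Iio i, wa γ (v i - μ (Fin.castLE h k))) *
      ∏ k ∈ Finset.Iio i, wa γ (v k - v i)) *
      (∏ k ∈ Finset.Ici (Fin.castLE h i), wa γ (w i - μ k)) *
      (∏ k ∈ Finset.Ioi i, wa γ (w k - w i)) +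
    φ₂ * φ₁⁻¹ * ((∏ k ∈ Finset.Iio i, wb (v i - μ (Fin.castLE h k))) *
      ∏ k ∈ Finset.Iio i, wa γ (v i - v k)) *
      (∏ k ∈ Finset.Ici (Fin.castLE h i), wb (w i - μ k)) *
      (∏ k ∈ Finset.Ioi i, wa γ (w i - w k))

/-- The on-shell kernel without its removable singularities. -/
noncomputable def regKernel : ℂ :=
  (-1) ^ (n * (n + 1) / 2) * wc γ ^ (2 * n) * (∏ i, ∏ j, wb (v i - μ j)) *
    (∏ i, ∏ j ∈ Finset.Ioi i, wb (v j - v i) * (wa γ (w j - μ (Fin.castLE h i)) *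
      (wb (w j - w i) * wb (w j - μ (Fin.castLE h i))))) *
    ∏ i, regLambda h γ φ₁ φ₂ μ w v i / numeratorR h γ μ w v i

/-- Every denominator other than the numerators of the `R_i` cancels against a factor of the
prefactor. Zeros of `R_i` need no exclusion, as both sides then contain the inverse of zero. -/
lemma kernelON_eq_regKernel (hr : RegularAt h γ μ w v) :
    kernelON h γ φ₁ φ₂ μ w v = regKernel h γ φ₁ φ₂ μ w v := by
  have hR : ∀ i, (factorR h γ μ w v i)⁻¹ =
      (wb (w i - μ (Fin.castLE h i)) * ∏ k ∈ Finset.Ioi i, wb (w k - μ (Fin.castLE h i))) *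
      (wb (v i - μ (Fin.castLE h i)) * ∏ k ∈ Finset.Ioi i, wb (v k - μ (Fin.castLE h i))) /
        numeratorR h γ μ w v i := by
    intro i
    have h1 : ∏ k ∈ Finset.Ici i, wb (w k - μ (Fin.castLE h i)) ≠ 0 :=
      Finset.prod_ne_zero_iff.2 fun k hk => hr.w_mu i k (Finset.mem_Ici.1 hk)
    have h2 : ∏ k ∈ Finset.Ici i, wb (v k - μ (Fin.castLE h i)) ≠ 0 :=
      Finset.prod_ne_zero_iff.2 fun k hk => hr.v_mu i k (Finset.mem_Ici.1 hk)
    rw [Finset.mul_prod_Ioi_eq_prod_Ici (f := fun k => wb (w k - μ (Fin.castLE h i))),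
      Finset.mul_prod_Ioi_eq_prod_Ici (f := fun k => wb (v k - μ (Fin.castLE h i))), inv_eq_iff_eq_inv,
      inv_div, factorR, numeratorR]
    simp only [Finset.prod_div_distrib, Finset.prod_mul_distrib]
    rw [div_sub_div _ _ h1 h2]
    ring
  have hdiv : ∀ s f A B A' B' r' {p q r : ℂ}, p ≠ 0 → q ≠ 0 → r ≠ 0 →
      s / p * A * B + f / q * A' * B' * (r' / r) =
        (s * (q * r) * A * B + f * (p * r') * A' * B') / (p * q * r) := by
    intros; field_simp
  have hdiv' : ∀ s c P X A B W Λ N : ℂ, ∀ {b1 b2 b3 b4 b5 : ℂ}, b1 ≠ 0 → b2 ≠ 0 → b3 ≠ 0 →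
      b4 ≠ 0 → b5 ≠ 0 →
      s * c * (P * (b5 * b4 * X) / b2) * (A * B / b1) *
        (b1 * W * (b2 * b3) / N * (Λ / (b3 * b4 * b5))) =
      s * c * P * (X * (A * (B * W))) * (Λ / N) := by
    intros; field_simp
  have hL : ∀ i, lambdaON h γ φ₁ φ₂ μ w v i =
      regLambda h γ φ₁ φ₂ μ w v i / ((∏ k ∈ Finset.Iio i, wb (v i - μ (Fin.castLE h k))) *
        (∏ k ∈ Finset.Iio i, wa γ (v i - μ (Fin.castLE h k))) *
        ∏ k ∈ Finset.Iio i, wa γ (v k - v i)) := by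
    intro i
    have h1 : ∏ k ∈ Finset.Iio i, wb (v i - μ (Fin.castLE h k)) ≠ 0 :=
      Finset.prod_ne_zero_iff.2 fun k hk => hr.v_mu k i (Finset.mem_Iio.1 hk).le
    have h2 : ∏ k ∈ Finset.Iio i, wa γ (v i - μ (Fin.castLE h k)) ≠ 0 :=
      Finset.prod_ne_zero_iff.2 fun k hk => hr.v_mu' i k (Finset.mem_Iio.1 hk)
    have h3 : ∏ k ∈ Finset.Iio i, wa γ (v k - v i) ≠ 0 :=
      Finset.prod_ne_zero_iff.2 fun k hk => hr.v_v i k (Finset.mem_Iio.1 hk)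
    rw [lambdaON, regLambda, Finset.prod_div_distrib, prod_Iio_castLE, prod_Iio_castLE]
    generalize ∏ k ∈ Finset.Iio i, wb (v i - μ (Fin.castLE h k)) = p at *
    generalize ∏ k ∈ Finset.Iio i, wa γ (v i - μ (Fin.castLE h k)) = q at *
    generalize ∏ k ∈ Finset.Iio i, wa γ (v k - v i) = r at *
    exact hdiv _ _ _ _ _ _ _ h1 h2 h3
  have hb1 : ∏ i, wb (w i - μ (Fin.castLE h i)) ≠ 0 :=
    Finset.prod_ne_zero_iff.2 fun i _ => hr.w_mu i i le_rfl
  have hb2 : ∏ i, wb (v i - μ (Fin.castLE h i)) ≠ 0 :=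
    Finset.prod_ne_zero_iff.2 fun i _ => hr.v_mu i i le_rfl
  have hb3 : ∏ i, ∏ k ∈ Finset.Ioi i, wb (v k - μ (Fin.castLE h i)) ≠ 0 :=
    Finset.prod_ne_zero_iff.2 fun i _ => Finset.prod_ne_zero_iff.2 fun k hk =>
      hr.v_mu i k (Finset.mem_Ioi.1 hk).le
  have hb4 : ∏ i, ∏ k ∈ Finset.Ioi i, wa γ (v k - μ (Fin.castLE h i)) ≠ 0 :=
    Finset.prod_ne_zero_iff.2 fun i _ => Finset.prod_ne_zero_iff.2 fun k hk =>
      hr.v_mu' k i (Finset.mem_Ioi.1 hk)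
  have hb5 : ∏ i, ∏ k ∈ Finset.Ioi i, wa γ (v i - v k) ≠ 0 :=
    Finset.prod_ne_zero_iff.2 fun i _ => Finset.prod_ne_zero_iff.2 fun k hk =>
      hr.v_v k i (Finset.mem_Ioi.1 hk)
  simp only [kernelON, regKernel, hR, hL, Finset.prod_mul_distrib, Finset.prod_div_distrib,
    prod_prod_Iio_comm]
  generalize ∏ i, wb (w i - μ (Fin.castLE h i)) = b1 at *
  generalize ∏ i, wb (v i - μ (Fin.castLE h i)) = b2 at *
  generalize ∏ i, ∏ k ∈ Finset.Ioi i, wb (v k - μ (Fin.castLE h i)) = b3 at *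
  generalize ∏ i, ∏ k ∈ Finset.Ioi i, wa γ (v k - μ (Fin.castLE h i)) = b4 at *
  generalize ∏ i, ∏ k ∈ Finset.Ioi i, wa γ (v i - v k) = b5 at *
  exact hdiv' _ _ _ _ _ _ _ _ _ hb1 hb2 hb3 hb4 hb5

variable {φ₁ φ₂ v}

/-- On shell the kernel is the kernel for arbitrary `v`. -/
lemma regKernel_eq_offKernel (hv : BetheEquations γ φ₁ φ₂ μ v) :
    regKernel h γ φ₁ φ₂ μ w v = offKernel h γ μ w v := by
  -- After multiplication by these factors the twisted term contains all `b(v_i - μ_j)` and all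
  -- `a(v_i - v_k)` with `k ≠ i`, which is the form in which the Bethe equation replaces `φ₂ / φ₁`.
  -- The sign `(-1)^(n-1)` turns the sum in `Λ_i` into the difference in `offLevel`.
  have hbr : ∀ i, ((∏ k ∈ Finset.Ici (Fin.castLE h i), wb (v i - μ k)) *
        ∏ k ∈ Finset.Ioi i, wa γ (v i - v k)) * regLambda h γ φ₁ φ₂ μ w v i =
      (-1) ^ n * ((∏ k ∈ Finset.Iio i, wa γ (v i - μ (Fin.castLE h k))) *
        ∏ k ∈ Finset.Iio i, wa γ (v k - v i)) *
      ((∏ k ∈ Finset.Ici (Fin.castLE h i), wa γ (w i - μ k) * wb (v i - μ k)) *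
        (∏ k ∈ Finset.Ioi i, wa γ (w k - w i) * wa γ (v i - v k)) -
      (∏ k ∈ Finset.Ici (Fin.castLE h i), wb (w i - μ k) * wa γ (v i - μ k)) *
        (∏ k ∈ Finset.Ioi i, wa γ (w i - w k) * wa γ (v k - v i))) := by
    intro i
    have hB := hv.equation i
    have h1 : ∏ j, wb (v i - μ j) ≠ 0 := Finset.prod_ne_zero_iff.2 fun j _ => hv.b_ne_zero i j
    have h2 : ∏ k ∈ Finset.univ.erase i, wa γ (v k - v i) ≠ 0 :=
      Finset.prod_ne_zero_iff.2 fun k hk => hv.a_ne_zero i k (Finset.ne_of_mem_erase hk)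
    have hn : (-1 : ℂ) ^ n = -(-1) ^ (n - 1) := by
      obtain ⟨m, rfl⟩ : ∃ m, n = m + 1 := ⟨n - 1, by have := i.2; omega⟩
      rw [pow_succ, Nat.add_sub_cancel]; ring
    rw [Finset.prod_div_distrib, Finset.prod_div_distrib, ← mul_div_assoc, div_eq_div_iff h1 h2,
      ← prod_Iio_mul_prod_Ioi, ← prod_Iio_mul_prod_Ioi,
      ← prod_Iio_mul_prod_Ici (Fin.castLE h i), ← prod_Iio_mul_prod_Ici (Fin.castLE h i),
      prod_Iio_castLE, prod_Iio_castLE] at hB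
    rw [regLambda, hn]
    simp only [Finset.prod_mul_distrib]
    have hs : ((-1 : ℂ) ^ (n - 1)) * (-1) ^ (n - 1) = 1 := by
      rw [← mul_pow]; simp
    generalize (-1 : ℂ) ^ (n - 1) = s at *
    rw [div_eq_mul_inv] at hB
    linear_combination ((∏ k ∈ Finset.Ici (Fin.castLE h i), wb (w i - μ k)) *
      (∏ k ∈ Finset.Ioi i, wa γ (w i - w k))) * (-s) * hB + (-(∏ k ∈ Finset.Ici (Fin.castLE h i), wb (v i - μ k)) *
      (∏ k ∈ Finset.Ioi i, wa γ (v i - v k)) * φ₂ * φ₁⁻¹ *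
      (∏ k ∈ Finset.Iio i, wb (v i - μ (Fin.castLE h k))) *
      (∏ k ∈ Finset.Iio i, wa γ (v i - v k)) *
      (∏ k ∈ Finset.Ici (Fin.castLE h i), wb (w i - μ k)) *
      (∏ k ∈ Finset.Ioi i, wa γ (w i - w k))) * hs
  have hb5 : ∏ i, ∏ k ∈ Finset.Ioi i, wa γ (v i - v k) ≠ 0 :=
    Finset.prod_ne_zero_iff.2 fun i _ => Finset.prod_ne_zero_iff.2 fun k hk =>
      hv.a_ne_zero k i (Finset.mem_Ioi.1 hk).ne
  have hP := Finset.prod_congr (s₁ := Finset.univ) rfl fun i _ => hbr i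
  have hsgn : ∏ i, ∏ k ∈ Finset.Ioi i, wb (v k - v i) =
      (∏ i : Fin n, ∏ _k ∈ Finset.Ioi i, (-1 : ℂ)) * ∏ i, ∏ k ∈ Finset.Ioi i, wb (v i - v k) := by
    simp only [← Finset.prod_mul_distrib]
    exact Finset.prod_congr rfl fun i _ => Finset.prod_congr rfl fun k _ => by
      rw [wb_sub_comm]; ring
  have hδ : ∏ i, ∏ j, wb (v i - μ j) =
      (∏ i, ∏ k ∈ Finset.Ioi i, wb (v k - μ (Fin.castLE h i))) *
        ∏ i, ∏ k ∈ Finset.Ici (Fin.castLE h i), wb (v i - μ k) := by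
    rw [← prod_prod_Iio_comm fun i k => wb (v i - μ (Fin.castLE h k)), ← Finset.prod_mul_distrib]
    exact Finset.prod_congr rfl fun i _ => by
      rw [← prod_Iio_mul_prod_Ici (Fin.castLE h i), prod_Iio_castLE]
  have hsg := neg_one_pow_mul_prod_Ioi (n := n)
  have hnn : ∏ _i : Fin n, (-1 : ℂ) ^ n = (-1) ^ n := by
    rw [Finset.prod_const, Finset.card_univ, Fintype.card_fin, ← pow_mul]
    rcases Nat.even_or_odd n with hn | hn
    · rw [hn.neg_one_pow, (hn.mul_right n).neg_one_pow]
    · rw [hn.neg_one_pow, (hn.mul hn).neg_one_pow]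
  have hnn2 : (-1 : ℂ) ^ n * (-1) ^ n = 1 := by rw [← mul_pow]; simp
  -- The product of the identities `hbr` carries the surplus factor `∏ a(v_i - v_k)` over `i < k`;
  -- the surplus `b` factors are already part of the kernel, by `hδ`.
  refine mul_left_cancel₀ hb5 ?_
  rw [regKernel, offKernel]
  simp only [offLevel, Finset.prod_mul_distrib, Finset.prod_div_distrib, prod_prod_Iio_comm, hnn,
    Finset.prod_const, Finset.card_univ, Fintype.card_fin, ← pow_mul] at hP ⊢
  rw [hsgn, hδ, div_eq_mul_inv, div_eq_mul_inv]
  generalize (∏ i, numeratorR h γ μ w v i)⁻¹ = N at *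
  generalize (-1 : ℂ) ^ (n * (n + 1) / 2) = s0 at *
  generalize ∏ i : Fin n, ∏ _k ∈ Finset.Ioi i, (-1 : ℂ) = s1 at *
  generalize (-1 : ℂ) ^ n = e at *
  generalize wc γ ^ (2 * n) = c at *
  generalize ∏ i, ∏ k ∈ Finset.Ioi i, wb (v k - μ (Fin.castLE h i)) = d3 at *
  generalize ∏ i, ∏ k ∈ Finset.Ici (Fin.castLE h i), wb (v i - μ k) = d4 at *
  generalize ∏ i, ∏ k ∈ Finset.Ioi i, wa γ (v k - μ (Fin.castLE h i)) = a3 at *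
  generalize ∏ i, ∏ k ∈ Finset.Ioi i, wa γ (v i - v k) = q5 at *
  generalize ∏ i, ∏ k ∈ Finset.Ioi i, wb (v i - v k) = q1 at *
  generalize ∏ i, ∏ k ∈ Finset.Ioi i, wa γ (w k - μ (Fin.castLE h i)) = x1 at *
  generalize ∏ i, ∏ k ∈ Finset.Ioi i, wb (w k - w i) = x2 at *
  generalize ∏ i, ∏ k ∈ Finset.Ioi i, wb (w k - μ (Fin.castLE h i)) = x3 at *
  generalize ∏ i, regLambda h γ φ₁ φ₂ μ w v i = Λ at *
  revert hP
  generalize Finset.prod Finset.univ (fun i : Fin n => (_ - _ : ℂ)) = br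
  intro hP
  linear_combination (c * d3 * q1 * x1 * x2 * x3 * N * (d4 * Λ * q5)) * hsg +
    (c * d3 * q1 * x1 * x2 * x3 * N * e) * hP +
    (c * d3 * q1 * x1 * x2 * x3 * N * a3 * q5 * br) * hnn2

end OnShell

/-! ### Unrolling the recursion for the kernel. -/

section Iteration

variable {L : ℕ}

/-- Downward induction on the level, with `d` the number of remaining steps. The function `g`
extends the coefficients to natural indices so that the product runs over an interval. -/
lemma kernelRec_eq_prod {m : ℕ} (h : m + 1 ≤ L) (γ φ₁ φ₂ : ℂ) (μ : Fin L → ℂ)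
    (w v : Fin (m + 1) → ℂ) (g : ℕ → ℂ)
    (hg : ∀ i : Fin m, g i = recCoeff h γ φ₁ φ₂ μ w v i.castSucc) (d s : ℕ) (hs : s < m + 1)
    (hd : s + d = m) :
    kernelRec h γ φ₁ φ₂ μ w v s hs =
      (∏ j ∈ Finset.Ico s m, g j) * recLast h γ φ₁ φ₂ μ w v (Fin.last m) := by
  induction d generalizing s with
  | zero =>
    obtain rfl : s = m := hd
    rw [kernelRec, dif_neg (by omega)]
    simp [Fin.last]
  | succ d ih =>
    have hsm : s < m := by omega
    rw [kernelRec, dif_pos (by omega), ih (s + 1) (by omega) (by omega),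
      Finset.prod_eq_prod_Ico_succ_bot hsm, mul_assoc]
    congr 1
    exact (hg ⟨s, hsm⟩).symm

lemma kernelRec_zero_eq {m : ℕ} (h : m + 1 ≤ L) (γ φ₁ φ₂ : ℂ) (μ : Fin L → ℂ)
    (w v : Fin (m + 1) → ℂ) (hm : 0 < m + 1) :
    kernelRec h γ φ₁ φ₂ μ w v 0 hm = (∏ i : Fin m, recCoeff h γ φ₁ φ₂ μ w v i.castSucc) *
      recLast h γ φ₁ φ₂ μ w v (Fin.last m) := by
  -- The default value `1` lies outside the range of the product.
  have hg : ∀ i : Fin m, (fun j : ℕ => if hj : j < m then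
      recCoeff h γ φ₁ φ₂ μ w v (Fin.castSucc ⟨j, hj⟩) else 1) i =
        recCoeff h γ φ₁ φ₂ μ w v i.castSucc := fun i => by simp
  rw [kernelRec_eq_prod h γ φ₁ φ₂ μ w v (fun j : ℕ => if hj : j < m then
      recCoeff h γ φ₁ φ₂ μ w v (Fin.castSucc ⟨j, hj⟩) else 1) hg m 0 hm (by omega), ← Finset.range_eq_Ico,
    Finset.prod_range]
  simp only [hg]

theorem kernelON_eq_recNorm_mul {n : ℕ} (hn : 1 ≤ n) (h : n ≤ L) (γ φ₁ φ₂ : ℂ) (μ : Fin L → ℂ)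
    (hμ : ∀ s k : Fin L, (s : ℕ) + 1 < n → s < k →
      wa γ (μ s - μ k) ≠ 0 ∧ wa γ (μ k - μ s) ≠ 0) (w v : Fin n → ℂ) :
    kernelON h γ φ₁ φ₂ μ w v = recNorm h γ μ * kernelRec h γ φ₁ φ₂ μ w v 0 hn := by
  obtain ⟨m, rfl⟩ : ∃ m, n = m + 1 := ⟨n - 1, by omega⟩
  have hD : ∏ i : Fin m, ∏ k ∈ Finset.Ioi (Fin.castLE h i.castSucc),
      wa γ (μ (Fin.castLE h i.castSucc) - μ k) * wa γ (μ k - μ (Fin.castLE h i.castSucc)) ≠ 0 :=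
    Finset.prod_ne_zero_iff.2 fun i _ => Finset.prod_ne_zero_iff.2 fun k hk => by
      have := hμ (Fin.castLE h i.castSucc) k (by simp) (Finset.mem_Ioi.1 hk)
      exact mul_ne_zero this.1 this.2
  have hf : ∀ f : Fin (m + 1) → ℂ, ∏ s ∈ Finset.univ.filter
      (fun s : Fin (m + 1) => (s : ℕ) + 1 < m + 1), f s = ∏ i : Fin m, f i.castSucc := fun f => by
    rw [Finset.prod_filter, Fin.prod_univ_castSucc]; simp
  have hlast : Finset.Ioi (Fin.last m) = ∅ := by
    ext k; simpa using Fin.le_last k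
  -- The three signs on the right come from the normalisation, from the `m` coefficients with
  -- `(-1)^L` each, and from the last term.
  have hsgn : (-1 : ℂ) ^ ((m + 1) * (m + 1 + 1) / 2) =
      (-1) ^ (m * L + (m + 1) * m / 2) * ((-1) ^ L) ^ m * (-1) ^ (m + 1) := by
    have e : (m + 1) * (m + 1 + 1) / 2 = (m + 1) * m / 2 + (m + 1) := by
      rw [← Nat.add_mul_div_right _ _ two_pos]; ring_nf
    have hs : (-1 : ℂ) ^ (m * L) * ((-1) ^ L) ^ m = 1 := by
      rw [← pow_mul, mul_comm L m, ← mul_pow]; simp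
    rw [e, pow_add, pow_add (-1 : ℂ) (m * L)]
    linear_combination (-(-1 : ℂ) ^ ((m + 1) * m / 2) * (-1) ^ (m + 1)) * hs
  rw [kernelRec_zero_eq, kernelON, recNorm, hf, hsgn]
  simp only [recCoeff, recLast, Finset.prod_mul_distrib, Finset.prod_div_distrib,
    Fin.prod_univ_castSucc (n := m), hlast, Finset.prod_empty, mul_one, Finset.prod_const,
    Finset.card_univ, Fintype.card_fin, Nat.add_sub_cancel] at hD ⊢
  have e2 : wc γ ^ (2 * (m + 1)) = wc γ ^ (2 * m) * wc γ ^ 2 := by ring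
  rw [e2]
  -- Only the product `D` of differences of the `μ` has to be cancelled. The other denominators
  -- occur alike on both sides, so nothing is required of `w` and `v`.
  have key : ∀ s t c c2 u P p V q a W b r Λ D f l : ℂ, D ≠ 0 →
      s * t * u * (c * c2) * (P * p * V / (q * a)) * (W / (b * r)) * (Λ * (f * l)) =
      s * c * D * (t * P * W / (b * q * D) * V * Λ * (u * c2 * (p / (r * a)) * f * l)) := by
    intro s t u c c2 P p V q a W b r Λ D f l hD
    simp only [div_eq_mul_inv, mul_inv]
    linear_combination (-(s * t * u * c * c2 * P * p * V * q⁻¹ * a⁻¹ * W * b⁻¹ * r⁻¹ * Λ * f * l)) *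
      mul_inv_cancel₀ hD
  rw [key _ _ _ _ _ _ _ _ _ _ _ _ _ _ _ _ _ hD]
  ring

end Iteration

/-! ### Multiple contour integrals as sums of residues. -/

section Residues

/-- The entire function `sinh z / z`. -/
noncomputable def sinhc (z : ℂ) : ℂ := dslope sinh 0 z

lemma wb_eq_mul_sinhc (z : ℂ) : wb z = z * sinhc z := by
  have := sub_smul_dslope sinh 0 z
  simpa [wb, sinhc] using this.symm

lemma sinhc_zero : sinhc 0 = 1 := by
  simp [sinhc, dslope_same]

lemma differentiable_sinhc : Differentiable ℂ sinhc := by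
  have h : DifferentiableOn ℂ sinhc Set.univ :=
    (Complex.differentiableOn_dslope Filter.univ_mem).2 differentiable_sinh.differentiableOn
  exact differentiableOn_univ.1 h

variable {N : ℕ} {Γ : Finset (ℂ × ℝ)} {p : Fin N → ℂ}

/-- In the region `sinh (z - p j)` can vanish only at `z = p j`, where `sinhc` equals `1`. Hence `1
/ b` is a simple pole times a holomorphic function there. -/
lemma Encloses.sinhc_ne_zero (hE : Encloses Γ p) {z : ℂ} (hz : z ∈ region Γ) (j : Fin N) :
    sinhc (z - p j) ≠ 0 := by
  intro h
  have h0 := hE.solely z hz j (by rw [wb_eq_mul_sinhc, h, mul_zero])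
  rw [h0, sub_self, sinhc_zero] at h
  exact one_ne_zero h

lemma mem_region {d : ℂ × ℝ} (hd : d ∈ Γ) {z : ℂ} (hz : z ∈ Metric.closedBall d.1 d.2) :
    z ∈ region Γ := Set.mem_biUnion hd hz

lemma curve_subset_region : curve Γ ⊆ region Γ :=
  Set.biUnion_mono subset_rfl fun _ _ => Metric.sphere_subset_closedBall

lemma Encloses.mem_region (hE : Encloses Γ p) (j : Fin N) : p j ∈ region Γ := by
  obtain ⟨d, hd, hj⟩ := hE.mem j
  exact SixVertex.mem_region hd (Metric.ball_subset_closedBall hj)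

/-- Each point is interior to some disc and the closed discs are disjoint, so a point outside one
open disc is not on its boundary either. -/
lemma Encloses.notMem_closedBall (hE : Encloses Γ p) {d : ℂ × ℝ} (hd : d ∈ Γ) {j : Fin N}
    (hj : p j ∉ Metric.ball d.1 d.2) : p j ∉ Metric.closedBall d.1 d.2 := by
  obtain ⟨d', hd', hj'⟩ := hE.mem j
  intro h
  rcases eq_or_ne d d' with rfl | hne
  · exact hj hj'
  · exact Set.disjoint_left.1 (hE.disjoint hd hd' hne) h (Metric.ball_subset_closedBall hj')

lemma Encloses.notMem_curve (hE : Encloses Γ p) (j : Fin N) : p j ∉ curve Γ := by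
  intro h
  obtain ⟨d, hd, hj⟩ := Set.mem_iUnion₂.1 h
  refine hE.notMem_closedBall hd ?_ (Metric.sphere_subset_closedBall hj)
  exact fun h' => (Metric.mem_ball.1 h').ne (Metric.mem_sphere.1 hj)

lemma Encloses.wb_ne_zero (hE : Encloses Γ p) {z : ℂ} (hz : z ∈ curve Γ) (j : Fin N) :
    wb (z - p j) ≠ 0 := fun h =>
  hE.notMem_curve j (hE.solely z (curve_subset_region hz) j h ▸ hz)

lemma Encloses.wb_sub_ne_zero (hE : Encloses Γ p) (hp : Function.Injective p) {i j : Fin N}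
    (hij : i ≠ j) : wb (p i - p j) ≠ 0 := fun h =>
  hij (hp (hE.solely _ (hE.mem_region i) j h))

open Classical in
/-- The indicator of the `j`-th point lying inside the circle `d`. -/
noncomputable def inside (p : Fin N → ℂ) (d : ℂ × ℝ) (j : Fin N) : ℂ :=
  if p j ∈ Metric.ball d.1 d.2 then 1 else 0

lemma Encloses.sum_inside (hE : Encloses Γ p) (j : Fin N) : ∑ d : Γ, inside p d j = 1 := by
  classical
  obtain ⟨d, hd, hj⟩ := hE.mem j
  rw [Finset.sum_eq_single ⟨d, hd⟩, inside, if_pos hj]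
  · intro d' _ hne
    refine if_neg fun h => ?_
    have hne' : (d' : ℂ × ℝ) ≠ d := fun h => hne (Subtype.ext h)
    exact Set.disjoint_left.1 (hE.disjoint d'.2 hd hne') (Metric.ball_subset_closedBall h)
      (Metric.ball_subset_closedBall hj)
  · simp

/-- Partial fractions, obtained by Lagrange interpolation of the constant `1` at the nodes `p j`. -/
lemma prod_sub_inv (hp : Function.Injective p) (hN : 0 < N) {z : ℂ} (hz : ∀ j, z ≠ p j) :
    (∏ j, (z - p j))⁻¹ =
      ∑ j, (∏ k ∈ Finset.univ.erase j, (p j - p k))⁻¹ * (z - p j)⁻¹ := by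
  have : Nonempty (Fin N) := ⟨⟨0, hN⟩⟩
  have h := Lagrange.eval_interpolate_not_at_node (s := Finset.univ) (v := p) (x := z) 1
    fun j _ => hz j
  rw [Lagrange.interpolate_one hp.injOn Finset.univ_nonempty, Lagrange.eval_nodal] at h
  simp only [Polynomial.eval_one, Pi.one_apply, mul_one, Lagrange.nodalWeight,
    Finset.prod_inv_distrib] at h
  exact inv_eq_of_mul_eq_one_right h.symm

/-- Put the `sinhc` factors into the numerator, split the remaining rational factor into partial
fractions, and apply Cauchy's formula at points inside the circle and Cauchy's theorem at those
outside. -/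
lemma Encloses.circleIntegral_div (hE : Encloses Γ p) (hp : Function.Injective p) (hN : 0 < N)
    {d : ℂ × ℝ} (hd : d ∈ Γ) {g : ℂ → ℂ}
    (hg : ∀ z ∈ Metric.closedBall d.1 d.2, DifferentiableAt ℂ g z) :
    (∮ z in C(d.1, d.2), g z / ∏ j, wb (z - p j)) = 2 * Real.pi * I *
      ∑ j, inside p d j * (g (p j) * (∏ k ∈ Finset.univ.erase j, wb (p j - p k))⁻¹) := by
  have hr := (hE.radius_pos d hd).le
  set f : ℂ → ℂ := fun z => g z / ∏ j, sinhc (z - p j) with hf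
  have hfd : ∀ z ∈ Metric.closedBall d.1 d.2, DifferentiableAt ℂ f z := by
    intro z hz
    refine (hg z hz).div ?_ (Finset.prod_ne_zero_iff.2 fun j _ =>
      hE.sinhc_ne_zero (SixVertex.mem_region hd hz) j)
    refine DifferentiableAt.fun_finsetProd fun j _ => ?_
    exact (differentiable_sinhc _).comp z (by fun_prop)
  have hfc : ContinuousOn f (Metric.closedBall d.1 d.2) := fun z hz =>
    (hfd z hz).continuousAt.continuousWithinAt
  have hne : ∀ z ∈ Metric.sphere d.1 d.2, ∀ j, z - p j ≠ 0 := fun z hz j h =>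
    hE.notMem_curve j (sub_eq_zero.1 h ▸ Set.mem_biUnion hd hz)
  have h1 : Set.EqOn (fun z => g z / ∏ j, wb (z - p j))
      (fun z => ∑ j, (∏ k ∈ Finset.univ.erase j, (p j - p k))⁻¹ * ((z - p j)⁻¹ • f z))
      (Metric.sphere d.1 d.2) := by
    intro z hz
    simp only [hf, wb_eq_mul_sinhc, Finset.prod_mul_distrib, smul_eq_mul]
    rw [div_mul_eq_div_div_swap, div_eq_mul_inv _ (∏ j, (z - p j)),
      prod_sub_inv hp hN fun j h => hne z hz j (sub_eq_zero.2 h), Finset.mul_sum]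
    exact Finset.sum_congr rfl fun j _ => by ring
  rw [circleIntegral.integral_congr hr h1, circleIntegral.integral_fun_sum, Finset.mul_sum]
  · refine Finset.sum_congr rfl fun j _ => ?_
    rw [circleIntegral.integral_const_mul]
    by_cases hj : p j ∈ Metric.ball d.1 d.2
    · rw [Complex.circleIntegral_sub_inv_smul_of_differentiable_on_off_countable
        Set.countable_empty hj hfc fun z hz => hfd z (Metric.ball_subset_closedBall hz.1)]
      -- The `sinhc` factor with `k = j` is `1`, so the residue recombines into a product of `b`
      -- over the other points.
      have h2 : ∏ k ∈ Finset.univ.erase j, wb (p j - p k) =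
          (∏ k ∈ Finset.univ.erase j, (p j - p k)) * ∏ k, sinhc (p j - p k) := by
        rw [← Finset.mul_prod_erase _ (fun k => sinhc (p j - p k)) (Finset.mem_univ j), sub_self,
          sinhc_zero, one_mul, ← Finset.prod_mul_distrib]
        exact Finset.prod_congr rfl fun k _ => wb_eq_mul_sinhc _
      simp only [hf]
      rw [h2, inside, if_pos hj, smul_eq_mul, mul_inv, div_eq_mul_inv]
      ring
    · rw [inside, if_neg hj, Complex.circleIntegral_eq_zero_of_differentiable_on_off_countable hr
        Set.countable_empty]
      · ring
      · refine ContinuousOn.smul (ContinuousOn.inv₀ (continuousOn_id.sub continuousOn_const) fun z hz h => ?_) hfc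
        exact hE.notMem_closedBall hd hj ((sub_eq_zero.1 h : z = p j) ▸ hz)
      · intro z hz
        have hz' := Metric.ball_subset_closedBall hz.1
        refine DifferentiableAt.smul (DifferentiableAt.inv (differentiableAt_id.sub_const _) fun h => ?_) (hfd z hz')
        exact hE.notMem_closedBall hd hj (sub_eq_zero.1 h ▸ hz')
  · intro j _
    refine ContinuousOn.circleIntegrable hr (continuousOn_const.mul (ContinuousOn.smul
      (ContinuousOn.inv₀ (continuousOn_id.sub continuousOn_const) fun z hz => hne z hz j)
      (hfc.mono Metric.sphere_subset_closedBall)))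

lemma torusMap_mem_sphere {n : ℕ} {c : Fin n → ℂ} {R : Fin n → ℝ} (hR : ∀ i, 0 ≤ R i)
    (θ : Fin n → ℝ) (i : Fin n) : torusMap c R θ i ∈ Metric.sphere (c i) (R i) := by
  simp [torusMap, Complex.norm_exp_ofReal_mul_I, abs_of_nonneg (hR i)]

lemma continuous_torusMap {n : ℕ} (c : Fin n → ℂ) (R : Fin n → ℝ) :
    Continuous (torusMap c R) := by
  unfold torusMap; fun_prop

lemma Encloses.torusMap_mem_curve (hE : Encloses Γ p) {n : ℕ} (d : Fin n → Γ) (θ : Fin n → ℝ)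
    (i : Fin n) :
    torusMap (fun i => (d i).1.1) (fun i => (d i).1.2) θ i ∈ curve Γ :=
  Set.mem_biUnion (d i).2 (torusMap_mem_sphere (fun i => (hE.radius_pos _ (d i).2).le) θ i)

lemma Encloses.torusIntegral_congr (hE : Encloses Γ p) {n : ℕ} (d : Fin n → Γ)
    {f g : (Fin n → ℂ) → ℂ} (hfg : ∀ w, (∀ i, w i ∈ curve Γ) → f w = g w) :
    (∯ w in T(fun i => (d i).1.1, fun i => (d i).1.2), f w) =
      ∯ w in T(fun i => (d i).1.1, fun i => (d i).1.2), g w := by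
  unfold torusIntegral
  congr 1
  funext θ
  exact congrArg _ (hfg _ (hE.torusMap_mem_curve d θ))

lemma Encloses.contourIntegral_congr (hE : Encloses Γ p) {n : ℕ}
    {f g : (Fin n → ℂ) → ℂ} (hfg : ∀ w, (∀ i, w i ∈ curve Γ) → f w = g w) :
    contourIntegral Γ f = contourIntegral Γ g := by
  unfold contourIntegral
  congr 1
  exact Finset.sum_congr rfl fun d _ => hE.torusIntegral_congr d hfg

lemma Encloses.prod_wb_ne_zero (hE : Encloses Γ p) {n : ℕ} {w : Fin n → ℂ}
    (hw : ∀ i, w i ∈ curve Γ) : ∏ i, ∏ j, wb (w i - p j) ≠ 0 :=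
  Finset.prod_ne_zero_iff.2 fun i _ => Finset.prod_ne_zero_iff.2 fun j _ =>
    hE.wb_ne_zero (hw i) j

lemma continuous_wb : Continuous wb := continuous_sinh

/-- Induction on the number of variables: the inner integrals, evaluated with the first variable on
its circle, leave a function holomorphic in that variable over the same `b`-product. -/
lemma Encloses.torusIntegral_div (hE : Encloses Γ p) (hp : Function.Injective p) (hN : 0 < N)
    {n : ℕ} (d : Fin n → Γ) {f : (Fin n → ℂ) → ℂ}
    (hf : ∀ w, (∀ i, w i ∈ region Γ) → DifferentiableAt ℂ f w) :
    (∯ w in T(fun i => (d i).1.1, fun i => (d i).1.2), f w / ∏ i, ∏ j, wb (w i - p j)) =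
      (2 * Real.pi * I) ^ n *
        ∑ σ : Fin n → Fin N, (∏ i, inside p (d i) (σ i)) * (f (p ∘ σ) * resWeight p σ) := by
  induction n with
  | zero =>
    rw [torusIntegral_dim0]
    simp [resWeight]
    congr 1
    exact Subsingleton.elim _ _
  | succ n ih =>
    rw [torusIntegral_succ]
    · have hr := (hE.radius_pos _ (d 0).2).le
      have h1 : Set.EqOn (fun z => ∯ y in T((fun i => (d i).1.1) ∘ Fin.succ,
            (fun i => (d i).1.2) ∘ Fin.succ), f (Fin.cons z y) /
              ∏ i, ∏ j, wb ((Fin.cons z y : Fin (n + 1) → ℂ) i - p j))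
          (fun z => ((2 * Real.pi * I) ^ n * ∑ σ : Fin n → Fin N,
            (∏ i, inside p (d i.succ) (σ i)) * (f (Fin.cons z (p ∘ σ)) * resWeight p σ)) /
              ∏ j, wb (z - p j)) (Metric.sphere (d 0).1.1 (d 0).1.2) := by
        intro z hz
        have hzr : z ∈ region Γ :=
          SixVertex.mem_region (d 0).2 (Metric.sphere_subset_closedBall hz)
        have hi := ih (fun i => d i.succ) (f := fun y => f (Fin.cons z y) / ∏ j, wb (z - p j))
          fun w hw => by
            simp only [div_eq_mul_inv]
            refine DifferentiableAt.mul_const (DifferentiableAt.comp w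
              (f := fun y : Fin n → ℂ => (Fin.cons z y : Fin (n + 1) → ℂ)) (hf _ ?_) ?_) _
            · exact Fin.cases hzr hw
            · exact differentiableAt_pi.2 (Fin.cases (differentiableAt_const _) fun i =>
                differentiableAt_apply i w)
        have he : ∀ y : Fin n → ℂ, f (Fin.cons z y) /
              ∏ i, ∏ j, wb ((Fin.cons z y : Fin (n + 1) → ℂ) i - p j) =
            f (Fin.cons z y) / (∏ j, wb (z - p j)) / ∏ i, ∏ j, wb (y i - p j) := by
          intro y
          rw [Fin.prod_univ_succ, div_div]
          rfl
        simp only [he]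
        refine hi.trans ?_
        rw [mul_div_assoc, Finset.sum_div]
        congr 1
        exact Finset.sum_congr rfl fun σ _ => by ring
      rw [circleIntegral.integral_congr hr h1,
        hE.circleIntegral_div hp hN (d 0).2 (g := fun z => (2 * Real.pi * I) ^ n *
          ∑ σ : Fin n → Fin N, (∏ i, inside p (d i.succ) (σ i)) *
            (f (Fin.cons z (p ∘ σ)) * resWeight p σ))]
      · rw [← (Fin.consEquiv fun _ => Fin N).sum_comp, Fintype.sum_prod_type, pow_succ]
        simp only [Finset.mul_sum, Finset.sum_mul]
        refine Finset.sum_congr rfl fun j _ => Finset.sum_congr rfl fun σ _ => ?_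
        have hc : p ∘ (Fin.consEquiv fun _ => Fin N) (j, σ) = Fin.cons (p j) (p ∘ σ) :=
          funext (Fin.cases rfl fun _ => rfl)
        rw [hc]
        simp only [Fin.consEquiv_apply, resWeight, Fin.prod_univ_succ, Fin.cons_zero,
          Fin.cons_succ]
        ring
      · intro z hz
        refine DifferentiableAt.const_mul (DifferentiableAt.fun_sum fun σ _ =>
          DifferentiableAt.const_mul (DifferentiableAt.mul_const
            (DifferentiableAt.comp z
              (f := fun z : ℂ => (Fin.cons z (p ∘ σ) : Fin (n + 1) → ℂ)) (hf _ ?_) ?_) _) _) _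
        · exact Fin.cases (SixVertex.mem_region (d 0).2 hz) fun i => hE.mem_region (σ i)
        · exact differentiableAt_pi.2 (Fin.cases differentiableAt_id fun i =>
            differentiableAt_const _)
    · refine ContinuousOn.integrableOn_compact isCompact_Icc fun θ _ => ContinuousAt.continuousWithinAt ?_
      have hθ := hE.torusMap_mem_curve d θ
      have ht := (continuous_torusMap (fun i => (d i).1.1) (fun i => (d i).1.2)).continuousAt (x := θ)
      refine ContinuousAt.div (ContinuousAt.comp
        (hf _ fun i => curve_subset_region (hθ i)).continuousAt ht) ?_ (hE.prod_wb_ne_zero hθ)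
      refine tendsto_finsetProd _ fun i _ => tendsto_finsetProd _ fun j _ => ?_
      have hc : Continuous fun θ : Fin (n + 1) → ℝ =>
          wb (torusMap (fun i => (d i).1.1) (fun i => (d i).1.2) θ i - p j) := by
        unfold torusMap wb
        fun_prop
      exact hc.tendsto θ

/-- For a fixed choice of residues the sum over all choices of circles factors into the sums of
`inside`, each equal to `1`, because every point lies in exactly one disc. -/
lemma Encloses.contourIntegral_div (hE : Encloses Γ p) (hp : Function.Injective p) (hN : 0 < N)
    {n : ℕ} {f : (Fin n → ℂ) → ℂ}
    (hf : ∀ w, (∀ i, w i ∈ region Γ) → DifferentiableAt ℂ f w) :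
    contourIntegral Γ (fun w => f w / ∏ i, ∏ j, wb (w i - p j)) =
      ∑ σ : Fin n → Fin N, f (p ∘ σ) * resWeight p σ := by
  have h2 : (2 * (Real.pi : ℂ) * I) ^ n ≠ 0 := pow_ne_zero _ two_pi_I_ne_zero
  unfold contourIntegral
  simp only [hE.torusIntegral_div hp hN _ hf]
  rw [← Finset.mul_sum, mul_div_cancel_left₀ _ h2, Finset.sum_comm]
  refine Finset.sum_congr rfl fun σ _ => ?_
  have hs := Finset.prod_univ_sum (fun _ : Fin n => (Finset.univ : Finset Γ))
    fun i d => inside p d (σ i)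
  rw [Fintype.piFinset_univ] at hs
  rw [← Finset.sum_mul, ← hs, Finset.prod_eq_one fun i _ => hE.sum_inside (σ i), one_mul]

end Residues

/-! ### Holomorphy of the regularised kernel, and its values at the residues. -/

section Regularity

variable {L n : ℕ} (h : n ≤ L) (γ φ₁ φ₂ : ℂ) (μ : Fin L → ℂ)

lemma differentiable_wa : Differentiable ℂ (wa γ) := by
  unfold wa; fun_prop

lemma differentiable_wb : Differentiable ℂ wb := differentiable_sinh

lemma differentiableAt_regKernel_left {w v : Fin n → ℂ} (hR : ∀ i, numeratorR h γ μ w v i ≠ 0) :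
    DifferentiableAt ℂ (fun w => regKernel h γ φ₁ φ₂ μ w v) w := by
  have ha := differentiable_wa γ
  have hb := differentiable_wb
  have hq (i : Fin n) : DifferentiableAt ℂ (fun w => regLambda h γ φ₁ φ₂ μ w v i /
      numeratorR h γ μ w v i) w := by
    simp only [div_eq_mul_inv]
    refine DifferentiableAt.fun_mul ?_
      (DifferentiableAt.fun_inv (h := fun w => numeratorR h γ μ w v i) ?_ (hR i))
    · unfold regLambda; fun_prop
    · unfold numeratorR; fun_prop
  unfold regKernel
  fun_prop

lemma differentiableAt_regKernel_right {w v : Fin n → ℂ} (hR : ∀ i, numeratorR h γ μ w v i ≠ 0) :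
    DifferentiableAt ℂ (fun v => regKernel h γ φ₁ φ₂ μ w v) v := by
  have ha := differentiable_wa γ
  have hb := differentiable_wb
  have hq (i : Fin n) : DifferentiableAt ℂ (fun v => regLambda h γ φ₁ φ₂ μ w v i /
      numeratorR h γ μ w v i) v := by
    simp only [div_eq_mul_inv]
    refine DifferentiableAt.fun_mul ?_
      (DifferentiableAt.fun_inv (h := fun v => numeratorR h γ μ w v i) ?_ (hR i))
    · unfold regLambda; fun_prop
    · unfold numeratorR; fun_prop
  unfold regKernel
  fun_prop

lemma regKernel_eq_zero (w v : Fin n → ℂ) (hv : ¬ Function.Injective v) :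
    regKernel h γ φ₁ φ₂ μ w v = 0 := by
  obtain ⟨i, j, hij, hne⟩ : ∃ i j, v i = v j ∧ i < j := by
    obtain ⟨i, j, hij, hne⟩ := Function.not_injective_iff.1 hv
    rcases lt_or_gt_of_ne hne with hl | hl
    exacts [⟨i, j, hij, hl⟩, ⟨j, i, hij.symm, hl⟩]
  have h0 : ∏ i, ∏ j ∈ Finset.Ioi i, wb (v j - v i) * (wa γ (w j - μ (Fin.castLE h i)) *
      (wb (w j - w i) * wb (w j - μ (Fin.castLE h i)))) = 0 := by
    refine Finset.prod_eq_zero (Finset.mem_univ i)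
      (Finset.prod_eq_zero (Finset.mem_Ioi.2 hne) ?_)
    rw [hij, sub_self, wb, sinh_zero, zero_mul]
  rw [regKernel, h0, mul_zero, zero_mul]

variable {γ φ₁ φ₂ μ}

lemma BetheEquations.comp_perm {y : Fin n → ℂ} (hy : BetheEquations γ φ₁ φ₂ μ y)
    (τ : Equiv.Perm (Fin n)) : BetheEquations γ φ₁ φ₂ μ (y ∘ τ) where
  twist_ne_zero := hy.twist_ne_zero
  b_ne_zero i := hy.b_ne_zero (τ i)
  a_ne_zero i k hk := hy.a_ne_zero (τ i) (τ k) (τ.injective.ne hk)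
  equation i := by
    refine (hy.equation (τ i)).trans (congrArg _ ?_)
    refine (Finset.prod_equiv τ (fun k => ?_) fun k _ => rfl).symm
    simp

/-- Permuted Bethe roots are again Bethe roots, so the on-shell identity applies at every
permutation; for a map that is not injective both kernels vanish. -/
lemma BetheEquations.regKernel_comp {y : Fin n → ℂ} (hy : BetheEquations γ φ₁ φ₂ μ y)
    (w : Fin n → ℂ) (τ : Fin n → Fin n) :
    regKernel h γ φ₁ φ₂ μ w (y ∘ τ) = offKernel h γ μ w (y ∘ τ) := by
  by_cases hτ : Function.Injective τ
  · exact regKernel_eq_offKernel h γ μ w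
      (hy.comp_perm (Equiv.ofBijective τ (Finite.injective_iff_bijective.1 hτ)))
  · have hyτ : ¬ Function.Injective (y ∘ τ) := fun hi => hτ hi.of_comp
    rw [regKernel_eq_zero h γ φ₁ φ₂ μ w _ hyτ,
      offKernel_eq_zero h γ μ w _ fun hi => hyτ hi.2]

end Regularity

/-! ### Separating coinciding points inside the contour. -/

section Deformation

variable {n : ℕ} {Γ : Finset (ℂ × ℝ)} {p : Fin n → ℂ}

lemma isCompact_region : IsCompact (region Γ) :=
  Γ.finite_toSet.isCompact_biUnion fun d _ => isCompact_closedBall d.1 d.2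

/-- A tuple of enclosed points is the limit of enclosed tuples of distinct points. -/
lemma Encloses.exists_deformation (hE : Encloses Γ p) :
    ∃ x : ℝ → Fin n → ℂ, Continuous x ∧ x 0 = p ∧ (∀ t, Encloses Γ (x t)) ∧
      ∀ t ≠ 0, Function.Injective (x t) := by
  have hq (j : Fin n) : Continuous fun s : ℝ => p j + s * (j : ℂ) := by fun_prop
  have h1 : ∀ᶠ s : ℝ in nhds 0, ∀ j, ∃ d ∈ Γ, p j + s * (j : ℂ) ∈ Metric.ball d.1 d.2 := by
    refine Filter.eventually_all.2 fun j => ?_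
    obtain ⟨d, hd, hj⟩ := hE.mem j
    have : ∀ᶠ s : ℝ in nhds 0, p j + s * (j : ℂ) ∈ Metric.ball d.1 d.2 :=
      (hq j).continuousAt.eventually_mem (Metric.isOpen_ball.mem_nhds (by simpa using hj))
    exact this.mono fun s hs => ⟨d, hd, hs⟩
  have h2 : ∀ᶠ s : ℝ in nhds 0, ∀ j, ∀ z ∈ region Γ, sinhc (z - (p j + s * (j : ℂ))) ≠ 0 := by
    refine Filter.eventually_all.2 fun j =>
      isCompact_region.eventually_forall_of_forall_eventually fun z hz => ?_
    have hc : Continuous fun q : ℝ × ℂ => sinhc (q.2 - (p j + q.1 * (j : ℂ))) :=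
      differentiable_sinhc.continuous.comp (by fun_prop)
    exact hc.continuousAt.eventually_ne (by simpa using hE.sinhc_ne_zero hz j)
  -- The shifts `s * j` separate points that coincide; a small `s` keeps distinct points apart.
  have h3 : ∀ᶠ s : ℝ in nhds 0, ∀ i j, p i ≠ p j → p i + s * (i : ℂ) ≠ p j + s * (j : ℂ) := by
    refine Filter.eventually_all.2 fun i => Filter.eventually_all.2 fun j => ?_
    by_cases hij : p i = p j
    · exact Filter.Eventually.of_forall fun s hs => absurd hij hs
    · have : ∀ᶠ s : ℝ in nhds 0, p i + s * (i : ℂ) - (p j + s * (j : ℂ)) ≠ 0 :=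
        ((hq i).sub (hq j)).continuousAt.eventually_ne (by simpa using sub_ne_zero.2 hij)
      exact this.mono fun s hs _ => sub_ne_zero.1 hs
  obtain ⟨ε, hε, H⟩ := Metric.eventually_nhds_iff.1 (h1.and (h2.and h3))
  -- A parameter that stays below `ε` for every real `t` and vanishes only at `t = 0`, so that the
  -- deformation is defined on the whole line.
  set s : ℝ → ℝ := fun t => ε / 2 * (t / (1 + t ^ 2)) with hs
  have hpos (t : ℝ) : 0 < 1 + t ^ 2 := by positivity
  have hsε (t : ℝ) : dist (s t) 0 < ε := by
    have : |t| ≤ 1 + t ^ 2 := by nlinarith [sq_abs t, sq_nonneg (|t| - 1), abs_nonneg t]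
    simp only [Real.dist_0_eq_abs, hs]
    rw [abs_mul, abs_div t, abs_of_pos (half_pos hε), abs_of_pos (hpos t)]
    have := (div_le_one (hpos t)).2 this
    nlinarith
  refine ⟨fun t j => p j + s t * (j : ℂ), ?_, ?_, fun t => ⟨hE.radius_pos, hE.disjoint, ?_, ?_⟩, ?_⟩
  · have : Continuous s := by
      refine continuous_const.mul (continuous_id.div (by fun_prop) fun t => (hpos t).ne')
    fun_prop
  · funext j; simp [hs]
  · exact (H (hsε t)).1
  · intro z hz j hj
    rw [wb_eq_mul_sinhc] at hj
    exact sub_eq_zero.1 ((mul_eq_zero.1 hj).resolve_right ((H (hsε t)).2.1 j z hz))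
  · intro t ht i j hij
    have hst : s t ≠ 0 := mul_ne_zero (half_pos hε).ne' (div_ne_zero ht (hpos t).ne')
    have hp : p i = p j := by
      by_contra hne
      exact (H (hsε t)).2.2 i j hne hij
    simp only [hp, add_right_inj] at hij
    have := mul_left_cancel₀ (ofReal_ne_zero.2 hst) hij
    exact Fin.ext (by exact_mod_cast this)

/-- Enclosed points never meet the curve, so the integrand is jointly continuous in `t` and the
angles, which run over a compact set. -/
lemma continuous_contourIntegral_div {f : (Fin n → ℂ) → ℂ} {x : ℝ → Fin n → ℂ}
    (hx : Continuous x) (hE : ∀ t, Encloses Γ (x t))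
    (hf : ∀ w, (∀ i, w i ∈ region Γ) → ContinuousAt f w) :
    Continuous fun t => contourIntegral Γ fun w => f w / ∏ i, ∏ j, wb (w i - x t j) := by
  unfold contourIntegral torusIntegral
  refine Continuous.div_const ?_ _
  refine continuous_finsetSum _ fun d _ => ?_
  refine continuous_parametric_integral_of_continuous ?_ isCompact_Icc
  have ht := continuous_torusMap (fun i => (d i).1.1) (fun i => (d i).1.2)
  have hft : Continuous fun θ => f (torusMap (fun i => (d i).1.1) (fun i => (d i).1.2) θ) :=
    continuous_iff_continuousAt.2 fun θ => ContinuousAt.comp (hf _ fun i =>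
      curve_subset_region ((hE 0).torusMap_mem_curve d θ i)) ht.continuousAt
  have hb := continuous_wb
  have hne (q : ℝ × (Fin n → ℝ)) :
      ∏ i, ∏ j, wb (torusMap (fun i => (d i).1.1) (fun i => (d i).1.2) q.2 i - x q.1 j) ≠ 0 :=
    (hE q.1).prod_wb_ne_zero ((hE q.1).torusMap_mem_curve d q.2)
  have hd : Continuous fun q : ℝ × (Fin n → ℝ) =>
      ∏ i, ∏ j, wb (torusMap (fun i => (d i).1.1) (fun i => (d i).1.2) q.2 i - x q.1 j) := by
    unfold torusMap
    fun_prop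
  have hm : Continuous fun q : ℝ × (Fin n → ℝ) =>
      ∏ i, (d i).1.2 * cexp (q.2 i * I) * I := by
    fun_prop
  exact hm.smul ((hft.comp continuous_snd).div hd hne)

end Deformation

/-! ### The contour integral formula. -/

section ContourIntegral

variable {L n : ℕ} (h : n ≤ L) {γ φ₁ φ₂ : ℂ} {μ : Fin L → ℂ} {x y : Fin n → ℂ}

lemma continuous_scalarProduct {X : Type*} [TopologicalSpace X] (γ : ℂ) (μ : Fin L → ℂ)
    {x : X → Fin n → ℂ} (hx : Continuous x) (y : Fin n → ℂ) :
    Continuous fun t => scalarProduct γ μ (x t) y := by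
  have hm (i : Fin n) : Continuous fun t => opC γ μ (x t i) :=
    ((continuous_apply_apply 1 0).comp (continuous_monodromy γ μ)).comp
      ((continuous_apply i).comp hx)
  have hl : Continuous fun t => (List.ofFn fun i => opC γ μ (x t i)).prod := by
    simp only [List.ofFn_eq_map]
    exact continuous_list_prod _ fun i _ => hm i
  unfold scalarProduct
  exact continuous_const.dotProduct ((hl.mul continuous_const).matrix_mulVec continuous_const)

/-- The on-shell scalar product as an iterated sum of residues in `v` and an integral in `w`. -/
lemma contourIntegral_kernelON (hn : 0 < n) (hy : Function.Injective y) {ΓC ΓB : Finset (ℂ × ℝ)}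
    (hC : Encloses ΓC x) (hB : Encloses ΓB y)
    (hr : ∀ w v : Fin n → ℂ, (∀ i, w i ∈ curve ΓC) → (∀ i, v i ∈ curve ΓB) → RegularAt h γ μ w v)
    (hR : ∀ w v : Fin n → ℂ, (∀ i, w i ∈ region ΓC) → (∀ i, v i ∈ region ΓB) →
      ∀ i, numeratorR h γ μ w v i ≠ 0) :
    (contourIntegral ΓC fun w => contourIntegral ΓB fun v =>
      kernelON h γ φ₁ φ₂ μ w v / ∏ i, ∏ j, wb (w i - x j) * wb (v i - y j)) =
    contourIntegral ΓC fun w =>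
      (∑ τ : Fin n → Fin n, regKernel h γ φ₁ φ₂ μ w (y ∘ τ) * resWeight y τ) /
        ∏ i, ∏ j, wb (w i - x j) := by
  refine hC.contourIntegral_congr fun w hw => ?_
  -- For fixed `w` the `b`-product in `w` is a constant. The regularised kernel is holomorphic in
  -- `v` throughout the region, whereas `kernelON` is controlled only on the curves.
  have h1 := hB.contourIntegral_div hy hn (n := n)
    (f := fun v => regKernel h γ φ₁ φ₂ μ w v * (∏ i, ∏ j, wb (w i - x j))⁻¹)
    fun v hv => (differentiableAt_regKernel_right h γ φ₁ φ₂ μ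
      (hR w v (fun i => curve_subset_region (hw i)) hv)).mul_const _
  rw [hB.contourIntegral_congr fun v hv => ?_, h1, div_eq_mul_inv, Finset.sum_mul]
  · exact Finset.sum_congr rfl fun τ _ => by ring
  · rw [kernelON_eq_regKernel h γ φ₁ φ₂ μ w v (hr w v hw hv)]
    simp only [Finset.prod_mul_distrib]
    rw [← div_div, div_eq_mul_inv (regKernel h γ φ₁ φ₂ μ w v)]

/-- For distinct `x` the residues in `w` reproduce the sum over permutations. Repeated values of `x`
are allowed, since both sides are continuous along a deformation into distinct points. -/
theorem scalarProduct_eq_contourIntegral (hn : 0 < n) (hy : Function.Injective y)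
    (hBA : BetheEquations γ φ₁ φ₂ μ y) {ΓC ΓB : Finset (ℂ × ℝ)}
    (hC : Encloses ΓC x) (hB : Encloses ΓB y)
    (hR : ∀ w v : Fin n → ℂ, (∀ i, w i ∈ region ΓC) → (∀ i, v i ∈ region ΓB) →
      ∀ i, numeratorR h γ μ w v i ≠ 0) :
    scalarProduct γ μ x y = contourIntegral ΓC fun w =>
      (∑ τ : Fin n → Fin n, regKernel h γ φ₁ φ₂ μ w (y ∘ τ) * resWeight y τ) /
        ∏ i, ∏ j, wb (w i - x j) := by
  have hd : ∀ w : Fin n → ℂ, (∀ i, w i ∈ region ΓC) → DifferentiableAt ℂ (fun w =>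
      ∑ τ : Fin n → Fin n, regKernel h γ φ₁ φ₂ μ w (y ∘ τ) * resWeight y τ) w := fun w hw =>
    DifferentiableAt.fun_sum fun τ _ => (differentiableAt_regKernel_left h γ φ₁ φ₂ μ
      (hR w _ hw fun i => hB.mem_region (τ i))).mul_const _
  obtain ⟨X, hXc, hX0, hXE, hXi⟩ := hC.exists_deformation
  have key : ∀ t ≠ 0, scalarProduct γ μ (X t) y = contourIntegral ΓC fun w =>
      (∑ τ : Fin n → Fin n, regKernel h γ φ₁ φ₂ μ w (y ∘ τ) * resWeight y τ) /
        ∏ i, ∏ j, wb (w i - X t j) := by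
    intro t ht
    rw [(hXE t).contourIntegral_div (hXi t ht) hn hd, scalarProduct_eq_sum h γ μ (X t) y
      (fun i j hij => (hXE t).wb_sub_ne_zero (hXi t ht) hij)
      (fun i j hij => hB.wb_sub_ne_zero hy hij)
      fun σ τ _ _ => hR _ _ (fun i => (hXE t).mem_region (σ i)) fun i => hB.mem_region (τ i)]
    refine Finset.sum_congr rfl fun σ _ => ?_
    rw [Finset.sum_mul]
    refine Finset.sum_congr rfl fun τ _ => ?_
    rw [hBA.regKernel_comp h]
    ring
  -- The two sides agree for all `t ≠ 0`, a dense set, hence also at `t = 0`, where the deformation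
  -- returns the given points.
  have := (continuous_scalarProduct γ μ hXc y).ext_on (dense_compl_singleton (0 : ℝ))
    (continuous_contourIntegral_div hXc hXE fun w hw => (hd w hw).continuousAt)
    fun t ht => key t ht
  simpa only [hX0] using congrFun this 0

end ContourIntegral

end SixVertex

theorem mainTheorem3 {L n : ℕ} (hn : 1 ≤ n) (hnL : n ≤ L) (γ φ₁ φ₂ : ℂ) (μ : Fin L → ℂ)
    (lamC lamB : Fin n → ℂ) (hB : Function.Injective lamB)
    (hBA : SixVertex.BetheEquations γ φ₁ φ₂ μ lamB) :
    (∀ ΓC ΓB : Finset (ℂ × ℝ),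
      SixVertex.Encloses ΓC lamC → SixVertex.Encloses ΓB lamB →
      (∀ w v : Fin n → ℂ, (∀ i, w i ∈ SixVertex.curve ΓC) → (∀ i, v i ∈ SixVertex.curve ΓB) →
        SixVertex.RegularAt hnL γ μ w v) →
      (∀ w v : Fin n → ℂ, (∀ i, w i ∈ SixVertex.region ΓC) → (∀ i, v i ∈ SixVertex.region ΓB) →
        ∀ i, SixVertex.numeratorR hnL γ μ w v i ≠ 0) →
      SixVertex.scalarProduct γ μ lamC lamB =
        SixVertex.contourIntegral ΓC fun w => SixVertex.contourIntegral ΓB fun v =>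
          SixVertex.kernelON hnL γ φ₁ φ₂ μ w v /
            ∏ i, ∏ j, SixVertex.wb (w i - lamC j) * SixVertex.wb (v i - lamB j)) ∧
    ((∀ s k : Fin L, (s : ℕ) + 1 < n → s < k →
        SixVertex.wa γ (μ s - μ k) ≠ 0 ∧ SixVertex.wa γ (μ k - μ s) ≠ 0) →
      ∀ w v : Fin n → ℂ,
        SixVertex.kernelON hnL γ φ₁ φ₂ μ w v =
          SixVertex.recNorm hnL γ μ * SixVertex.kernelRec hnL γ φ₁ φ₂ μ w v 0 hn) :=
  ⟨fun _ _ hC hE hr hR => (SixVertex.scalarProduct_eq_contourIntegral hnL hn hB hBA hC hE hR).trans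
      (SixVertex.contourIntegral_kernelON hnL hn hB hC hE hr hR).symm,
    fun hμ w v => SixVertex.kernelON_eq_recNorm_mul hn hnL γ φ₁ φ₂ μ hμ w v⟩
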